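/- Let $N\ge 1$, let $\mu$ be a finite nonnegative Borel measure on $(0,1)$, and let $s_\sharp\in(0,1)$ be such that $\mu([s_\sharp,1))>0$. Let $\Omega\subset\mathbb{R}^N$ be a bounded open set with Lipschitz boundary, and let $g\in L^1(\mathbb{R}^N\setminus\Omega)$. For $s\in(0,1)$ put $$c_{N,s}:=-\frac{2^{2s-1}\,\Gamma\!\left(\frac{N+2s}{2}\right)}{\pi^{N/2}\,\Gamma(-s)}>0,\qquad \mathcal Q:=\mathbb{R}^{2N}\setminus(\mathbb{R}^N\setminus\Omega)^2,\qquad [u]_s^2:=c_{N,s}\iint_{\mathcal Q}\frac{|u(x)-u(y)|^2}{|x-y|^{N+2s}}\,dx\,dy .$$ Let $\mathcal H_\mu(\Omega)$ be the space of all measurable functions $u:\mathbb{R}^N\to\mathbb{R}$ with $\|u\|_\mu<+\infty$, where $$\|u\|_\mu:=\left(\|u\|_{L^2(\Omega)}^2+\big\||g|^{1/2}u\big\|_{L^2(\mathbb{R}^N\setminus\Omega)}^2+\frac12\int_{(0,1)}[u]_s^2\,d\mu(s)\right)^{1/2},$$ and let $H^{s_\sharp}(\Omega)$ be the fractional Sobolev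 space of all measurable functions $u$ on $\Omega$ with $$\|u\|_{H^{s_\sharp}(\Omega)}:=\left(\|u\|_{L^2(\Omega)}^2+\iint_{\Omega\times\Omega}\frac{|u(x)-u(y)|^2}{|x-y|^{N+2s_\sharp}}\,dx\,dy\right)^{1/2}<+\infty .$$ Let $2^*_{s_\sharp}:=\frac{2N}{N-2s_\sharp}$ if $2s_\sharp<N$, and $2^*_{s_\sharp}:=+\infty$ otherwise (which can occur only for $N=1$). Then $\mathcal H_\mu(\Omega)$ is continuously embedded in $H^{s_\sharp}(\Omega)$: for every $u\in\mathcal H_\mu(\Omega)$ the restriction $u|_\Omega$ belongs to $H^{s_\sharp}(\Omega)$, and there is a constant $C$ such that $\|u\|_{H^{s_\sharp}(\Omega)}\le C\|u\|_\mu$ for all $u\in\mathcal H_\mu(\Omega)$. Moreover, for every $q\in[1,2^*_{s_\sharp})$ the space $\mathcal H_\mu(\Omega)$ is compactly embedded in $L^q(\Omega)$: the restriction map $u\mapsto u|_\Omega$ is well defined and bounded from $\mathcal H_\mu(\Omega)$ to $L^q(\Omega)$, and for every sequence in $\mathcal H_\mu(\Omega)$ that is bounded with respect to $\|\cdot\|_\mu$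 the restrictions to $\Omega$ have a subsequence that converges in $L^q(\Omega)$. -/

import Mathlib

open MeasureTheory Set Filter Topology
open scoped NNReal ENNReal RealInnerProductSpace

noncomputable section

namespace SuperposedFractional

/-- The normalizing constant of the fractional Laplacian of order `s` in dimension `N`
(for `s ∈ (0,1)` one has `Γ(-s) < 0`, hence the constant is positive). -/
def cNs (N : ℕ) (s : ℝ) : ℝ :=
  -((2 : ℝ) ^ (2 * s - 1) * Real.Gamma (((N : ℝ) + 2 * s) / 2)) /
    (Real.pi ^ ((N : ℝ) / 2) * Real.Gamma (-s))

/-- The double integral of `|u(x) - u(y)|² / |x - y|^(N + 2s)` over a set `A` of pairs `(x, y)`. -/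
def gagliardo (N : ℕ) (s : ℝ) (A : Set (EuclideanSpace ℝ (Fin N) × EuclideanSpace ℝ (Fin N)))
    (u : EuclideanSpace ℝ (Fin N) → ℝ) : ℝ≥0∞ :=
  ∫⁻ p in A, ENNReal.ofReal (|u p.1 - u p.2| ^ 2 / ‖p.1 - p.2‖ ^ ((N : ℝ) + 2 * s))

/-- `𝒬 = ℝ^{2N} \ (ℝ^N \ Ω)²`. -/
def crossSet {N : ℕ} (Ω : Set (EuclideanSpace ℝ (Fin N))) :
    Set (EuclideanSpace ℝ (Fin N) × EuclideanSpace ℝ (Fin N)) :=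
  (Ωᶜ ×ˢ Ωᶜ)ᶜ

/-- The square `[u]_s²` of the Gagliardo seminorm on `𝒬`. -/
def seminormSq {N : ℕ} (Ω : Set (EuclideanSpace ℝ (Fin N))) (s : ℝ)
    (u : EuclideanSpace ℝ (Fin N) → ℝ) : ℝ≥0∞ :=
  ENNReal.ofReal (cNs N s) * gagliardo N s (crossSet Ω) u

/-- The norm `‖u‖_μ` (with values in `[0, ∞]`) attached to the weight `g` on `ℝ^N \ Ω`. A Borel
measure on `(0,1)` is represented by a measure on `ℝ`, of which only the restriction to `(0,1)` is
ever used. -/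
def muNorm {N : ℕ} (Ω : Set (EuclideanSpace ℝ (Fin N))) (g : EuclideanSpace ℝ (Fin N) → ℝ)
    (μ : Measure ℝ) (u : EuclideanSpace ℝ (Fin N) → ℝ) : ℝ≥0∞ :=
  (eLpNorm u 2 (volume.restrict Ω) ^ 2
    + eLpNorm (fun x => Real.sqrt |g x| * u x) 2 (volume.restrict Ωᶜ) ^ 2
    + 2⁻¹ * ∫⁻ s in Ioo (0 : ℝ) 1, seminormSq Ω s u ∂μ) ^ (1 / 2 : ℝ)

/-- The space `𝓗_μ(Ω)`: the (Lebesgue) measurable functions `u : ℝ^N → ℝ` with `‖u‖_μ < ∞`. -/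
def HmuSpace {N : ℕ} (Ω : Set (EuclideanSpace ℝ (Fin N))) (g : EuclideanSpace ℝ (Fin N) → ℝ)
    (μ : Measure ℝ) : Set (EuclideanSpace ℝ (Fin N) → ℝ) :=
  {u | AEMeasurable u volume ∧ muNorm Ω g μ u < ∞}

/-- The norm of the fractional Sobolev space `H^s(Ω)`; it only depends on `u` on `Ω`. -/
def HsNorm {N : ℕ} (Ω : Set (EuclideanSpace ℝ (Fin N))) (s : ℝ)
    (u : EuclideanSpace ℝ (Fin N) → ℝ) : ℝ≥0∞ :=
  (eLpNorm u 2 (volume.restrict Ω) ^ 2 + gagliardo N s (Ω ×ˢ Ω) u) ^ (1 / 2 : ℝ)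

/-- The fractional Sobolev space `H^s(Ω)`. Its elements are written as functions on `ℝ^N`, of which
only the restriction to `Ω` matters. -/
def HsSpace {N : ℕ} (Ω : Set (EuclideanSpace ℝ (Fin N))) (s : ℝ) :
    Set (EuclideanSpace ℝ (Fin N) → ℝ) :=
  {u | AEMeasurable u (volume.restrict Ω) ∧ HsNorm Ω s u < ∞}

/-- The norm of `L^q(Ω)`. -/
def LqNorm {N : ℕ} (Ω : Set (EuclideanSpace ℝ (Fin N))) (q : ℝ≥0∞)
    (u : EuclideanSpace ℝ (Fin N) → ℝ) : ℝ≥0∞ :=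
  eLpNorm u q (volume.restrict Ω)

/-- The Lebesgue space `L^q(Ω)`, again with elements written as functions on `ℝ^N`, of which only
the restriction to `Ω` matters. -/
def LqSpace {N : ℕ} (Ω : Set (EuclideanSpace ℝ (Fin N))) (q : ℝ≥0∞) :
    Set (EuclideanSpace ℝ (Fin N) → ℝ) :=
  {u | MemLp u q (volume.restrict Ω)}

/-- `V` with the norm `p` is continuously embedded in `W` with the norm `r`. When `W` is a space of
functions on `Ω` (as above) and `V` is a space of functions on `ℝ^N`, this says that the operator
`u ↦ u|_Ω` is well defined and bounded from `V` to `W`. -/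
structure IsContinuouslyEmbedded {N : ℕ} (V : Set (EuclideanSpace ℝ (Fin N) → ℝ))
    (p : (EuclideanSpace ℝ (Fin N) → ℝ) → ℝ≥0∞) (W : Set (EuclideanSpace ℝ (Fin N) → ℝ))
    (r : (EuclideanSpace ℝ (Fin N) → ℝ) → ℝ≥0∞) : Prop where
  subset : V ⊆ W
  bound : ∃ C : ℝ≥0, ∀ u ∈ V, r u ≤ C * p u

/-- `V` with the norm `p` is compactly embedded in `W` with the norm `r`: it is continuously
embedded, and each bounded sequence of `V` has a subsequence that converges in `W`. -/
structure IsCompactlyEmbedded {N : ℕ} (V : Set (EuclideanSpace ℝ (Fin N) → ℝ))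
    (p : (EuclideanSpace ℝ (Fin N) → ℝ) → ℝ≥0∞) (W : Set (EuclideanSpace ℝ (Fin N) → ℝ))
    (r : (EuclideanSpace ℝ (Fin N) → ℝ) → ℝ≥0∞) : Prop
    extends IsContinuouslyEmbedded V p W r where
  exists_subseq : ∀ u : ℕ → EuclideanSpace ℝ (Fin N) → ℝ, (∀ n, u n ∈ V) →
    (∃ M : ℝ≥0, ∀ n, p (u n) ≤ M) →
    ∃ w ∈ W, ∃ φ : ℕ → ℕ, StrictMono φ ∧ Tendsto (fun n => r (u (φ n) - w)) atTop (𝓝 0)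

/-- `Ω` has Lipschitz boundary: near each boundary point, `Ω` is the set of points that lie
strictly above the graph of a Lipschitz function, in the direction of some unit vector `e`, the
graph being taken over the hyperplane orthogonal to `e`. -/
def HasLipschitzBoundary {N : ℕ} (Ω : Set (EuclideanSpace ℝ (Fin N))) : Prop :=
  ∀ x₀ ∈ frontier Ω, ∃ (r : ℝ) (e : EuclideanSpace ℝ (Fin N)) (K : ℝ≥0)
    (γ : (Submodule.span ℝ {e})ᗮ → ℝ), 0 < r ∧ ‖e‖ = 1 ∧ LipschitzWith K γ ∧
      ∀ y ∈ Metric.ball x₀ r,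
        (y ∈ Ω ↔ γ ((Submodule.span ℝ {e})ᗮ.orthogonalProjectionOnto y) < ⟪e, y⟫)

/-- The critical exponent `2N / (N - 2s)`, read as `∞` if `N ≤ 2s`. -/
def critExp (N : ℕ) (s : ℝ) : ℝ≥0∞ :=
  if 2 * s < N then ENNReal.ofReal (2 * (N : ℝ) / ((N : ℝ) - 2 * s)) else ∞

end SuperposedFractional

end

/-!
The assumption `μ([s,1)) > 0` enters only through `∫_{[s,1)} c_{N,σ} dμ(σ) > 0`: as `Ω` is bounded,
the kernel of order `s` is at most a constant times the kernel of any order `σ ∈ [s,1)`, and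
integrating in `σ` bounds the Gagliardo seminorm of order `s` on `Ω` by `‖u‖_μ`
(`exists_gagliardo_le_muNorm`). What remains is the Sobolev and Rellich–Kondrachov theorem for
`H^s(Ω)` (`isCompactlyEmbedded_HsSpace_LqSpace`), which is proved without an extension operator.

The Lipschitz boundary is only used to see that `Ω` fills a fixed fraction of each small ball
centred in `Ω` (`exists_measureDensity`). Since the Gagliardo seminorm is nonlocal, this already
gives the Poincaré-type estimate that `u(x)` differs from the average of `u` over `Ω ∩ B(z, r)`,
`|x - z| < r`, by at most `C r^s G(x)^(1/2)`, where `∫_Ω G = [u]²` (`enorm_sub_average_sq_le`).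

* Integrability: an `L^p` bound controls that average by `C r^(-N/p)`. Choosing `r` such that this
  is half of `|u(x)|` yields the pointwise bound `|u|^P ≤ C (1 + G)` with `P = 2 + 2sp/N`
  (`abs_rpow_le_of_approx`), hence an `L^P` bound. Iterating from `p = 2`, the exponents
  approach the critical one, the fixed point of `p ↦ 2 + 2sp/N`, or tend to infinity
  (`exists_sobolevBound_gt`).
* Compactness: in a bounded sequence, pass to a subsequence along which the averages over
  countably many balls converge. As `u` is approximated in `L²` by finitely many averages, uniformly
  on bounded sets, the subsequence is Cauchy in `L²(Ω)` (`exists_subseq_cauchy_two`), and in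
  `L^q(Ω)` by interpolation with a bound in some `L^p`, `p > q`.
-/

namespace SuperposedFractional

variable {N : ℕ} {Ω : Set (EuclideanSpace ℝ (Fin N))}

/-! ### Measure density of Lipschitz domains -/

/-- Above a Lipschitz graph, the point `x + (r / 2) e` is the centre of a ball of radius comparable
to `r` which stays above the graph. -/
lemma exists_ball_subset_of_lipschitz_graph {x₀ e : EuclideanSpace ℝ (Fin N)} {R : ℝ} {K : ℝ≥0}
    {γ : (Submodule.span ℝ {e})ᗮ → ℝ} (he : ‖e‖ = 1) (hγ : LipschitzWith K γ)
    (hΩ : ∀ y ∈ Metric.ball x₀ R,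
      (y ∈ Ω ↔ γ ((Submodule.span ℝ {e})ᗮ.orthogonalProjectionOnto y) < ⟪e, y⟫))
    {x : EuclideanSpace ℝ (Fin N)} (hx : x ∈ Ω) {r : ℝ} (hr : 0 < r)
    (hxr : Metric.ball x r ⊆ Metric.ball x₀ R) :
    Metric.ball (x + (r / 2) • e) ((4 * (K + 1 : ℝ))⁻¹ * r) ⊆ Ω ∩ Metric.ball x r := by
  have hK : (0 : ℝ) ≤ K := K.2
  set η : ℝ := (4 * (K + 1 : ℝ))⁻¹ with hη
  have hη0 : 0 < η := by positivity
  have hηK : η * (4 * (K + 1 : ℝ)) = 1 := inv_mul_cancel₀ (by positivity)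
  have hη4 : η ≤ 1 / 4 := by nlinarith
  intro y hy
  obtain ⟨w, rfl⟩ : ∃ w, y = x + (r / 2) • e + w := ⟨y - (x + (r / 2) • e), by abel⟩
  have hw : ‖w‖ < η * r := by
    simpa [Metric.mem_ball, dist_eq_norm] using hy
  have hyx : x + (r / 2) • e + w ∈ Metric.ball x r := by
    rw [Metric.mem_ball, dist_eq_norm, add_assoc, add_sub_cancel_left]
    calc ‖(r / 2) • e + w‖ ≤ ‖(r / 2) • e‖ + ‖w‖ := norm_add_le _ _
      _ = r / 2 + ‖w‖ := by rw [norm_smul, he, Real.norm_of_nonneg (by positivity), mul_one]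
      _ < r := by nlinarith
  refine ⟨?_, hyx⟩
  rw [hΩ _ (hxr hyx)]
  have hx' := (hΩ x (hxr (Metric.mem_ball_self hr))).1 hx
  set P := (Submodule.span ℝ {e})ᗮ.orthogonalProjectionOnto with hP
  have hPe : P e = 0 := by
    rw [hP, Submodule.orthogonalProjectionOnto_eq_zero_iff]
    exact Submodule.le_orthogonal_orthogonal _ (Submodule.mem_span_singleton_self e)
  have hPy : P (x + (r / 2) • e + w) = P x + P w := by
    rw [map_add, map_add, map_smul, hPe, smul_zero, add_zero]
  have hlip : γ (P x + P w) ≤ γ (P x) + K * ‖w‖ := by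
    have h1 := hγ.dist_le_mul (P x + P w) (P x)
    rw [Real.dist_eq, dist_eq_norm, add_sub_cancel_left] at h1
    have h2 := Submodule.norm_orthogonalProjectionOnto_apply_le (Submodule.span ℝ {e})ᗮ w
    have h3 := le_abs_self (γ (P x + P w) - γ (P x))
    have h4 := mul_le_mul_of_nonneg_left h2 hK
    linarith
  have hew : -‖w‖ ≤ ⟪e, w⟫ := by
    have := abs_real_inner_le_norm e w
    rw [he, one_mul] at this
    exact (abs_le.1 this).1
  have hee : ⟪e, e⟫ = 1 := by rw [real_inner_self_eq_norm_sq, he, one_pow]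
  rw [hPy, inner_add_right, inner_add_right, inner_smul_right, hee]
  have hw' : (K + 1) * ‖w‖ < r / 2 := by nlinarith
  linarith

/-- The interior corkscrew condition. It holds near each point of `closure Ω`, with local constants,
and compactness of `closure Ω` makes the constants uniform. -/
lemma exists_corkscrew (hΩo : IsOpen Ω) (hΩb : Bornology.IsBounded Ω)
    (hΩL : HasLipschitzBoundary Ω) :
    ∃ η > 0, ∃ r₀ > 0, ∀ x ∈ Ω, ∀ r, 0 < r → r ≤ r₀ →
      ∃ z, Metric.ball z (η * r) ⊆ Ω ∩ Metric.ball x r := by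
  have hcpt : IsCompact (closure Ω) := hΩb.isCompact_closure
  have key : ∃ η > 0, ∃ r₀ > 0, ∀ x ∈ Ω ∩ closure Ω, ∀ r, 0 < r → r ≤ r₀ →
      ∃ z, Metric.ball z (η * r) ⊆ Ω ∩ Metric.ball x r := by
    refine hcpt.induction_on (p := fun S => ∃ η > 0, ∃ r₀ > 0, ∀ x ∈ Ω ∩ S, ∀ r, 0 < r → r ≤ r₀ →
      ∃ z, Metric.ball z (η * r) ⊆ Ω ∩ Metric.ball x r) ?_ ?_ ?_ ?_
    · exact ⟨1, one_pos, 1, one_pos, fun x hx => absurd hx.2 (notMem_empty x)⟩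
    · rintro S T hST ⟨η, hη, r₀, hr₀, h⟩
      exact ⟨η, hη, r₀, hr₀, fun x hx => h x ⟨hx.1, hST hx.2⟩⟩
    · rintro S T ⟨η, hη, r₀, hr₀, h⟩ ⟨η', hη', r₀', hr₀', h'⟩
      refine ⟨min η η', lt_min hη hη', min r₀ r₀', lt_min hr₀ hr₀', ?_⟩
      rintro x ⟨hxΩ, hx | hx⟩ r hr hrr
      · obtain ⟨z, hz⟩ := h x ⟨hxΩ, hx⟩ r hr (hrr.trans (min_le_left _ _))
        exact ⟨z, (Metric.ball_subset_ball (by gcongr; exact min_le_left _ _)).trans hz⟩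
      · obtain ⟨z, hz⟩ := h' x ⟨hxΩ, hx⟩ r hr (hrr.trans (min_le_right _ _))
        exact ⟨z, (Metric.ball_subset_ball (by gcongr; exact min_le_right _ _)).trans hz⟩
    · intro x₀ hx₀
      by_cases hx₀Ω : x₀ ∈ Ω
      · obtain ⟨ε, hε, hball⟩ := Metric.isOpen_iff.1 hΩo x₀ hx₀Ω
        refine ⟨Metric.ball x₀ (ε / 2),
          mem_nhdsWithin_of_mem_nhds (Metric.ball_mem_nhds _ (by positivity)),
          1, one_pos, ε / 2, by positivity, fun x hx r hr hrr => ⟨x, ?_⟩⟩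
        rw [one_mul]
        refine subset_inter ((Metric.ball_subset_ball' ?_).trans hball) subset_rfl
        have := Metric.mem_ball.1 hx.2
        linarith
      · have hfr : x₀ ∈ frontier Ω := ⟨hx₀, by rwa [hΩo.interior_eq]⟩
        obtain ⟨R, e, K, γ, hR, he, hγ, hΩ⟩ := hΩL x₀ hfr
        refine ⟨Metric.ball x₀ (R / 2),
          mem_nhdsWithin_of_mem_nhds (Metric.ball_mem_nhds _ (by positivity)),
          (4 * (K + 1 : ℝ))⁻¹, by positivity, R / 2, by positivity, fun x hx r hr hrr =>
            ⟨_, exists_ball_subset_of_lipschitz_graph he hγ hΩ hx.1 hr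
              (Metric.ball_subset_ball' ?_)⟩⟩
        have := Metric.mem_ball.1 hx.2
        linarith
  obtain ⟨η, hη, r₀, hr₀, h⟩ := key
  exact ⟨η, hη, r₀, hr₀, fun x hx => h x ⟨hx, subset_closure hx⟩⟩

/-- The measure density condition with constant `c` up to scale `r₀`: `Ω` fills at least the
fraction `c` of the volume `r ^ N` in each ball of radius `r ≤ r₀` centred in `Ω`. -/
def MeasureDensity (Ω : Set (EuclideanSpace ℝ (Fin N))) (c r₀ : ℝ) : Prop :=
  ∀ x ∈ Ω, ∀ r, 0 < r → r ≤ r₀ →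
    ENNReal.ofReal (c * r ^ (N : ℝ)) ≤ volume (Ω ∩ Metric.ball x r)

lemma exists_measureDensity (hΩo : IsOpen Ω) (hΩb : Bornology.IsBounded Ω)
    (hΩL : HasLipschitzBoundary Ω) : ∃ c > 0, ∃ r₀ > 0, MeasureDensity Ω c r₀ := by
  obtain ⟨η, hη, r₀, hr₀, h⟩ := exists_corkscrew hΩo hΩb hΩL
  set b := volume (Metric.ball (0 : EuclideanSpace ℝ (Fin N)) 1) with hb
  have hb0 : 0 < b := Metric.measure_ball_pos _ _ one_pos
  have hbt : b ≠ ∞ := measure_ball_lt_top.ne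
  refine ⟨η ^ N * b.toReal, mul_pos (by positivity) (ENNReal.toReal_pos hb0.ne' hbt), r₀, hr₀,
    fun x hx r hr hrr => ?_⟩
  obtain ⟨z, hz⟩ := h x hx r hr hrr
  refine le_trans (le_of_eq ?_) (measure_mono hz)
  rw [Measure.addHaar_ball_of_pos _ _ (by positivity), ← hb, finrank_euclideanSpace_fin,
    Real.rpow_natCast, mul_right_comm, ← mul_pow, ENNReal.ofReal_mul (by positivity),
    ENNReal.ofReal_toReal hbt]

/-! ### The superposed seminorm dominates a fractional Sobolev seminorm -/

/-- The sign comes from `Γ(-s)`, which is negative because `-s Γ(-s) = Γ(1 - s) > 0`. -/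
lemma cNs_pos {s : ℝ} (hs : s ∈ Ioo (0 : ℝ) 1) : 0 < cNs N s := by
  have h0 : 0 < s := hs.1
  have h1 := Real.Gamma_add_one (s := -s) (by linarith)
  have h2 : 0 < Real.Gamma (-s + 1) := Real.Gamma_pos_of_pos (by linarith [hs.2])
  have hneg : Real.Gamma (-s) < 0 := by
    by_contra hcon
    push Not at hcon
    nlinarith
  have h3 : 0 < Real.Gamma (((N : ℝ) + 2 * s) / 2) := Real.Gamma_pos_of_pos (by positivity)
  have hpi := Real.pi_pos
  exact div_pos_of_neg_of_neg (neg_neg_of_pos (by positivity))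
    (mul_neg_of_pos_of_neg (by positivity) hneg)

lemma continuousOn_cNs : ContinuousOn (cNs N) (Ioo (0 : ℝ) 1) := by
  have hΓ : ∀ s ∈ Ioo (0 : ℝ) 1, ∀ m : ℕ, -s ≠ -(m : ℝ) := by
    intro s hs m hm
    have h : s = m := by linarith
    have h0 : (0 : ℝ) < m := h ▸ hs.1
    have h1 : (m : ℝ) < 1 := h ▸ hs.2
    norm_cast at h0 h1
    omega
  intro s hs
  have h0 : 0 < s := hs.1
  have hpi := Real.pi_pos
  have hcont : ContinuousAt (fun t : ℝ => Real.Gamma (-t)) s :=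
    (Real.differentiableAt_Gamma (hΓ s hs)).continuousAt.comp continuous_neg.continuousAt
  have hcont2 : ContinuousAt (fun t : ℝ => Real.Gamma (((N : ℝ) + 2 * t) / 2)) s := by
    refine ContinuousAt.comp (g := Real.Gamma)
      (Real.differentiableAt_Gamma fun m hm => ?_).continuousAt (by fun_prop)
    have : (0 : ℝ) ≤ m := m.cast_nonneg
    have : 0 < ((N : ℝ) + 2 * s) / 2 := by positivity
    linarith
  have hpow : ContinuousAt (fun t : ℝ => (2 : ℝ) ^ (2 * t - 1)) s :=
    ContinuousAt.rpow continuousAt_const (by fun_prop) (Or.inl two_ne_zero)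
  refine (ContinuousAt.div (hpow.mul hcont2).neg (continuousAt_const.mul hcont)
    (mul_ne_zero (by positivity) ?_)).continuousWithinAt
  exact Real.Gamma_ne_zero (hΓ s hs)

/-- On a set of diameter at most `D`, the singular kernel of order `s` is controlled by the one of
any larger order `σ < 1`. -/
lemma gagliardo_le_of_le {s σ D : ℝ} (hs : 0 < s) (hsσ : s ≤ σ) (hσ : σ < 1) (hD : 1 ≤ D)
    (hΩm : MeasurableSet Ω) (hΩD : ∀ x ∈ Ω, ∀ y ∈ Ω, ‖x - y‖ ≤ D)
    (u : EuclideanSpace ℝ (Fin N) → ℝ) :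
    gagliardo N s (Ω ×ˢ Ω) u ≤ ENNReal.ofReal (D ^ 2) * gagliardo N σ (Ω ×ˢ Ω) u := by
  unfold gagliardo
  rw [← lintegral_const_mul' _ _ ENNReal.ofReal_ne_top]
  refine setLIntegral_mono' (hΩm.prod hΩm) fun p hp => ?_
  rw [← ENNReal.ofReal_mul (by positivity)]
  refine ENNReal.ofReal_le_ofReal ?_
  rcases eq_or_lt_of_le (norm_nonneg (p.1 - p.2)) with hd | hd
  · have : p.1 = p.2 := by rwa [eq_comm, norm_sub_eq_zero_iff] at hd
    simp [this]
  · have hle := hΩD _ hp.1 _ hp.2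
    set d := ‖p.1 - p.2‖
    have hpow : d ^ ((N : ℝ) + 2 * σ) ≤ D ^ 2 * d ^ ((N : ℝ) + 2 * s) := by
      have h1 : (N : ℝ) + 2 * σ = 2 * (σ - s) + ((N : ℝ) + 2 * s) := by ring
      rw [h1, Real.rpow_add hd]
      gcongr
      calc d ^ (2 * (σ - s)) ≤ D ^ (2 * (σ - s)) := by gcongr
        _ ≤ D ^ (2 : ℝ) := Real.rpow_le_rpow_of_exponent_le hD (by linarith)
        _ = D ^ 2 := by norm_cast
    rw [← mul_div_assoc, div_le_div_iff₀ (by positivity) (by positivity)]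
    nlinarith [sq_nonneg (|u p.1 - u p.2|)]

/-- The integral of `c_{N,σ}` over `[s,1)` is positive, which is where the assumption on `μ` is
used; so the superposed seminorm dominates the Gagliardo seminorm of order `s` on `Ω`. -/
lemma exists_gagliardo_le_muNorm (hΩo : IsOpen Ω) (hΩb : Bornology.IsBounded Ω)
    (g : EuclideanSpace ℝ (Fin N) → ℝ) (μ : Measure ℝ) {s : ℝ} (hs : s ∈ Ioo (0 : ℝ) 1)
    (hμs : 0 < μ (Ico s 1)) :
    ∃ C : ℝ≥0, ∀ u, gagliardo N s (Ω ×ˢ Ω) u ≤ C * muNorm Ω g μ u ^ (2 : ℝ) := by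
  have hsub : Ico s 1 ⊆ Ioo (0 : ℝ) 1 := fun σ hσ => ⟨hs.1.trans_le hσ.1, hσ.2⟩
  obtain ⟨D₀, hD₀⟩ := hΩb.exists_norm_le
  set D := max 1 (2 * D₀) with hDdef
  have hD : 1 ≤ D := le_max_left _ _
  have hΩD : ∀ x ∈ Ω, ∀ y ∈ Ω, ‖x - y‖ ≤ D := fun x hx y hy => by
    have := norm_sub_le x y
    have := hD₀ x hx
    have := hD₀ y hy
    exact le_trans (by linarith) (le_max_right _ _)
  set c := ∫⁻ σ in Ico s 1, ENNReal.ofReal (cNs N σ) ∂μ with hc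
  have hcpos : 0 < c := by
    have hmeas : AEMeasurable (fun σ => ENNReal.ofReal (cNs N σ)) (μ.restrict (Ico s 1)) :=
      ((continuousOn_cNs.mono hsub).aemeasurable measurableSet_Ico).ennreal_ofReal
    rw [pos_iff_ne_zero, hc, Ne, lintegral_eq_zero_iff' hmeas]
    intro h0
    have h1 : ∀ᵐ σ ∂μ.restrict (Ico s 1), False := by
      filter_upwards [h0, ae_restrict_mem measurableSet_Ico] with σ hσ hσs
      have := cNs_pos (N := N) (hsub hσs)
      simp only [Pi.zero_apply, ENNReal.ofReal_eq_zero] at hσ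
      linarith
    rw [ae_iff] at h1
    simp only [not_false_eq_true, ofPred_true, Measure.restrict_apply_univ] at h1
    exact hμs.ne' h1
  obtain ⟨c', hc'0, hc'⟩ := ENNReal.lt_iff_exists_nnreal_btwn.1 hcpos
  have hc'0' : 0 < c' := by exact_mod_cast hc'0
  refine ⟨c'⁻¹ * (2 * (D ^ 2).toNNReal), fun u => ?_⟩
  have hint : c * gagliardo N s (Ω ×ˢ Ω) u ≤
      ENNReal.ofReal (D ^ 2) * ∫⁻ σ in Ioo (0 : ℝ) 1, seminormSq Ω σ u ∂μ := by
    calc c * gagliardo N s (Ω ×ˢ Ω) u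
        ≤ ∫⁻ σ in Ico s 1, ENNReal.ofReal (cNs N σ) * gagliardo N s (Ω ×ˢ Ω) u ∂μ :=
          lintegral_mul_const_le _ _
      _ ≤ ∫⁻ σ in Ico s 1, ENNReal.ofReal (D ^ 2) * seminormSq Ω σ u ∂μ := by
          refine setLIntegral_mono' measurableSet_Ico fun σ hσ => ?_
          rw [seminormSq, mul_left_comm]
          gcongr
          refine (gagliardo_le_of_le hs.1 hσ.1 hσ.2 hD hΩo.measurableSet hΩD u).trans ?_
          gcongr
          refine lintegral_mono_set ?_
          rintro p ⟨hp1, _⟩ ⟨hp, _⟩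
          exact hp hp1
      _ = ENNReal.ofReal (D ^ 2) * ∫⁻ σ in Ico s 1, seminormSq Ω σ u ∂μ :=
          lintegral_const_mul' _ _ ENNReal.ofReal_ne_top
      _ ≤ _ := by gcongr
  have hmu : ∫⁻ σ in Ioo (0 : ℝ) 1, seminormSq Ω σ u ∂μ ≤ 2 * muNorm Ω g μ u ^ (2 : ℝ) := by
    rw [muNorm, ← ENNReal.rpow_mul]
    norm_num
    rw [mul_add, ← mul_assoc 2 2⁻¹, ENNReal.mul_inv_cancel two_ne_zero ENNReal.ofNat_ne_top, one_mul]
    exact le_add_self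
  have h1 : (c' : ℝ≥0∞) * gagliardo N s (Ω ×ˢ Ω) u ≤
      ENNReal.ofReal (D ^ 2) * (2 * muNorm Ω g μ u ^ (2 : ℝ)) :=
    (mul_le_mul_left hc'.le _).trans (hint.trans (mul_le_mul_right hmu _))
  have h2 : ((c'⁻¹ * (2 * (D ^ 2).toNNReal) : ℝ≥0) : ℝ≥0∞) =
      (c' : ℝ≥0∞)⁻¹ * (2 * ENNReal.ofReal (D ^ 2)) := by
    rw [ENNReal.coe_mul, ENNReal.coe_inv hc'0'.ne', ENNReal.coe_mul]
    rfl
  have hc'1 : (c' : ℝ≥0∞) ≠ 0 := by exact_mod_cast hc'0'.ne'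
  rw [h2]
  calc gagliardo N s (Ω ×ˢ Ω) u
      = (c' : ℝ≥0∞)⁻¹ * (c' * gagliardo N s (Ω ×ˢ Ω) u) := by
        rw [← mul_assoc, ENNReal.inv_mul_cancel hc'1 ENNReal.coe_ne_top, one_mul]
    _ ≤ (c' : ℝ≥0∞)⁻¹ * (ENNReal.ofReal (D ^ 2) * (2 * muNorm Ω g μ u ^ (2 : ℝ))) := by gcongr
    _ = _ := by ring

theorem isContinuouslyEmbedded_HmuSpace_HsSpace (hΩo : IsOpen Ω) (hΩb : Bornology.IsBounded Ω)
    (g : EuclideanSpace ℝ (Fin N) → ℝ) (μ : Measure ℝ) {s : ℝ} (hs : s ∈ Ioo (0 : ℝ) 1)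
    (hμs : 0 < μ (Ico s 1)) :
    IsContinuouslyEmbedded (HmuSpace Ω g μ) (muNorm Ω g μ) (HsSpace Ω s) (HsNorm Ω s) := by
  obtain ⟨C, hC⟩ := exists_gagliardo_le_muNorm hΩo hΩb g μ hs hμs
  have hbound : ∀ u, HsNorm Ω s u ≤ ((1 + C) ^ (1 / 2 : ℝ) : ℝ≥0) * muNorm Ω g μ u := by
    intro u
    have h1 : eLpNorm u 2 (volume.restrict Ω) ^ 2 ≤ muNorm Ω g μ u ^ (2 : ℝ) := by
      rw [muNorm, ← ENNReal.rpow_mul]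
      norm_num
      rw [add_assoc]
      exact le_self_add
    have h2 : muNorm Ω g μ u = (muNorm Ω g μ u ^ (2 : ℝ)) ^ (1 / 2 : ℝ) := by
      rw [← ENNReal.rpow_mul]; norm_num
    rw [ENNReal.coe_rpow_of_nonneg _ (by norm_num : (0 : ℝ) ≤ 1 / 2), h2,
      ← ENNReal.mul_rpow_of_nonneg _ _ (by norm_num : (0 : ℝ) ≤ 1 / 2)]
    refine ENNReal.rpow_le_rpow ?_ (by norm_num)
    rw [ENNReal.coe_add, ENNReal.coe_one, add_mul, one_mul]
    exact add_le_add h1 (hC u)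
  exact ⟨fun u hu => ⟨hu.1.restrict,
    (hbound u).trans_lt (ENNReal.mul_lt_top ENNReal.coe_lt_top hu.2)⟩, _, fun u _ => hbound u⟩

/-! ### Averages over small balls and Hedberg's trick -/

/-- The inner integral `∫_Ω |u(x) - u(y)|² / |x - y|^(N + 2s) dy` of the Gagliardo seminorm. -/
noncomputable def localEnergy (Ω : Set (EuclideanSpace ℝ (Fin N))) (s : ℝ) (u : EuclideanSpace ℝ (Fin N) → ℝ)
    (x : EuclideanSpace ℝ (Fin N)) : ℝ≥0∞ :=
  ∫⁻ y in Ω, ENNReal.ofReal (|u x - u y| ^ 2 / ‖x - y‖ ^ ((N : ℝ) + 2 * s))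

lemma aemeasurable_gagliardo_integrand {s : ℝ} {u : EuclideanSpace ℝ (Fin N) → ℝ}
    (hu : AEMeasurable u (volume.restrict Ω)) :
    AEMeasurable (fun p : EuclideanSpace ℝ (Fin N) × EuclideanSpace ℝ (Fin N) =>
      ENNReal.ofReal (|u p.1 - u p.2| ^ 2 / ‖p.1 - p.2‖ ^ ((N : ℝ) + 2 * s)))
      ((volume.restrict Ω).prod (volume.restrict Ω)) := by
  have h1 := hu.comp_fst (ν := volume.restrict Ω)
  have h2 := hu.comp_snd (μ := volume.restrict Ω)
  have h3 : AEMeasurable (fun p : EuclideanSpace ℝ (Fin N) × EuclideanSpace ℝ (Fin N) =>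
      |u p.1 - u p.2|) ((volume.restrict Ω).prod (volume.restrict Ω)) := by
    simpa [Real.norm_eq_abs] using (h1.sub h2).norm
  refine ((h3.pow_const 2).div (Measurable.aemeasurable ?_)).ennreal_ofReal
  fun_prop

lemma lintegral_localEnergy {s : ℝ} {u : EuclideanSpace ℝ (Fin N) → ℝ}
    (hu : AEMeasurable u (volume.restrict Ω)) :
    ∫⁻ x in Ω, localEnergy Ω s u x = gagliardo N s (Ω ×ˢ Ω) u := by
  unfold localEnergy gagliardo
  rw [Measure.volume_eq_prod, ← Measure.prod_restrict,
    lintegral_prod _ (aemeasurable_gagliardo_integrand hu)]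

lemma sq_lintegral_le_lintegral_sq {α : Type*} [MeasurableSpace α] {ν : Measure α}
    [IsProbabilityMeasure ν] {f : α → ℝ≥0∞} (hf : AEMeasurable f ν) :
    (∫⁻ x, f x ∂ν) ^ 2 ≤ ∫⁻ x, f x ^ 2 ∂ν := by
  have h := ENNReal.lintegral_mul_le_Lp_mul_Lq ν Real.HolderConjugate.two_two hf
    (aemeasurable_const (b := (1 : ℝ≥0∞)))
  simp only [Pi.mul_apply, mul_one, ENNReal.one_rpow, lintegral_const, measure_univ] at h
  calc (∫⁻ x, f x ∂ν) ^ 2 ≤ ((∫⁻ x, f x ^ (2 : ℝ) ∂ν) ^ (1 / 2 : ℝ)) ^ 2 := by gcongr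
    _ = ∫⁻ x, f x ^ 2 ∂ν := by
      rw [← ENNReal.rpow_natCast, ← ENNReal.rpow_mul]
      norm_num

/-- Averages over `Ω ∩ B(z, r)` are integrals against a probability measure. -/
lemma isProbabilityMeasure_smul_restrict_ball {c r₀ : ℝ} (hc : 0 < c) (hd : MeasureDensity Ω c r₀)
    {z : EuclideanSpace ℝ (Fin N)} (hz : z ∈ Ω) {r : ℝ} (hr : 0 < r) (hrr : r ≤ r₀) :
    IsProbabilityMeasure
      ((volume (Ω ∩ Metric.ball z r))⁻¹ • volume.restrict (Ω ∩ Metric.ball z r)) := by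
  have h0 : volume (Ω ∩ Metric.ball z r) ≠ 0 := by
    refine (lt_of_lt_of_le ?_ (hd z hz r hr hrr)).ne'
    rw [ENNReal.ofReal_pos]
    positivity
  have ht : volume (Ω ∩ Metric.ball z r) ≠ ∞ :=
    ((measure_mono inter_subset_right).trans_lt measure_ball_lt_top).ne
  refine ⟨?_⟩
  rw [Measure.smul_apply, Measure.restrict_apply_univ, smul_eq_mul, ENNReal.inv_mul_cancel h0 ht]

lemma inv_volume_inter_ball_le {c r₀ : ℝ} (hc : 0 < c) (hd : MeasureDensity Ω c r₀)
    {z : EuclideanSpace ℝ (Fin N)} (hz : z ∈ Ω) {r : ℝ} (hr : 0 < r) (hrr : r ≤ r₀) :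
    (volume (Ω ∩ Metric.ball z r))⁻¹ ≤ ENNReal.ofReal ((c * r ^ (N : ℝ))⁻¹) := by
  rw [ENNReal.ofReal_inv_of_pos (by positivity)]
  exact ENNReal.inv_le_inv.2 (hd z hz r hr hrr)

/-- The deviation of `u(x)` from the average of `u` over `Ω ∩ B(z, r)`, `|x - z| < r`, is of order
`r ^ s`, by the Cauchy–Schwarz inequality and `|x - y| ≤ 2r` for `y` in this set. -/
lemma enorm_sub_average_sq_le {c r₀ s : ℝ} (hc : 0 < c) (hs : 0 < s) (hΩo : IsOpen Ω)
    (hd : MeasureDensity Ω c r₀) {u : EuclideanSpace ℝ (Fin N) → ℝ} (hu : IntegrableOn u Ω)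
    {x z : EuclideanSpace ℝ (Fin N)} (hz : z ∈ Ω) {r : ℝ} (hr : 0 < r) (hrr : r ≤ r₀)
    (hxz : dist x z < r) :
    ‖u x - ⨍ y in Ω ∩ Metric.ball z r, u y‖ₑ ^ 2 ≤
      ENNReal.ofReal (2 ^ ((N : ℝ) + 2 * s) / c * r ^ (2 * s)) * localEnergy Ω s u x := by
  have := isProbabilityMeasure_smul_restrict_ball hc hd hz hr hrr
  set A := Ω ∩ Metric.ball z r with hA
  have hAm : MeasurableSet A := hΩo.measurableSet.inter measurableSet_ball
  set ν := (volume A)⁻¹ • volume.restrict A with hν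
  have hV : (volume A)⁻¹ ≤ ENNReal.ofReal ((c * r ^ (N : ℝ))⁻¹) :=
    inv_volume_inter_ball_le hc hd hz hr hrr
  have huν : Integrable u ν :=
    (hu.mono_set inter_subset_left).smul_measure (hV.trans_lt ENNReal.ofReal_lt_top).ne
  have havg : ⨍ y in A, u y = ∫ y, u y ∂ν := by
    rw [average, Measure.restrict_apply_univ]
  have hsub : u x - ∫ y, u y ∂ν = ∫ y, (u x - u y) ∂ν := by
    rw [integral_sub (integrable_const _) huν]
    simp
  rw [havg, hsub]
  have hmeas : AEMeasurable (fun y => ‖u x - u y‖ₑ) ν :=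
    ((aemeasurable_const.sub huν.aemeasurable)).enorm
  calc ‖∫ y, (u x - u y) ∂ν‖ₑ ^ 2 ≤ (∫⁻ y, ‖u x - u y‖ₑ ∂ν) ^ 2 := by
        gcongr; exact enorm_integral_le_lintegral_enorm _
    _ ≤ ∫⁻ y, ‖u x - u y‖ₑ ^ 2 ∂ν := sq_lintegral_le_lintegral_sq hmeas
    _ = (volume A)⁻¹ * ∫⁻ y in A, ‖u x - u y‖ₑ ^ 2 := by
        rw [hν, lintegral_smul_measure, smul_eq_mul]
    _ ≤ ENNReal.ofReal ((c * r ^ (N : ℝ))⁻¹) *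
          (ENNReal.ofReal ((2 * r) ^ ((N : ℝ) + 2 * s)) * localEnergy Ω s u x) := by
        gcongr
        unfold localEnergy
        rw [← lintegral_const_mul' _ _ ENNReal.ofReal_ne_top]
        refine (setLIntegral_mono' hAm fun y hy => ?_).trans (lintegral_mono_set inter_subset_left)
        rw [← ofReal_norm, ← ENNReal.ofReal_pow (norm_nonneg _),
          ← ENNReal.ofReal_mul (by positivity), Real.norm_eq_abs]
        refine ENNReal.ofReal_le_ofReal ?_
        rcases eq_or_lt_of_le (norm_nonneg (x - y)) with h0 | h0
        · have : x = y := by rwa [eq_comm, norm_sub_eq_zero_iff] at h0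
          simp [this]
        · have hle : ‖x - y‖ ≤ 2 * r := by
            have h1 := dist_triangle_right x y z
            have h2 := Metric.mem_ball.1 hy.2
            rw [← dist_eq_norm]
            linarith
          rw [← mul_div_assoc, le_div_iff₀ (by positivity), mul_comm]
          gcongr
    _ = _ := by
        rw [← mul_assoc, ← ENNReal.ofReal_mul (by positivity)]
        congr 2
        rw [Real.mul_rpow (by norm_num) hr.le, Real.rpow_add hr]
        field_simp

/-- Averages over `Ω ∩ B(z, r)` are at most of order `r ^ (-N / p)` for functions of `L^p(Ω)`. -/
lemma enorm_average_le {c r₀ p : ℝ} (hc : 0 < c) (hp : 1 ≤ p)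
    (hd : MeasureDensity Ω c r₀) {u : EuclideanSpace ℝ (Fin N) → ℝ}
    (hu : AEStronglyMeasurable u (volume.restrict Ω))
    {z : EuclideanSpace ℝ (Fin N)} (hz : z ∈ Ω) {r : ℝ} (hr : 0 < r) (hrr : r ≤ r₀) :
    ‖⨍ y in Ω ∩ Metric.ball z r, u y‖ₑ ≤
      ENNReal.ofReal (c ^ (-(1 / p)) * r ^ (-((N : ℝ) / p))) *
        eLpNorm u (ENNReal.ofReal p) (volume.restrict Ω) := by
  have := isProbabilityMeasure_smul_restrict_ball hc hd hz hr hrr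
  set A := Ω ∩ Metric.ball z r with hA
  set ν := (volume A)⁻¹ • volume.restrict A with hν
  have hV : (volume A)⁻¹ ≤ ENNReal.ofReal ((c * r ^ (N : ℝ))⁻¹) :=
    inv_volume_inter_ball_le hc hd hz hr hrr
  have huA : AEStronglyMeasurable u (volume.restrict A) :=
    hu.mono_measure (Measure.restrict_mono_set _ inter_subset_left)
  have huν : AEStronglyMeasurable u ν := huA.smul_measure _
  have havg : ⨍ y in A, u y = ∫ y, u y ∂ν := by
    rw [average, Measure.restrict_apply_univ]
  have hp0 : 0 < p := by linarith
  rw [havg]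
  calc ‖∫ y, u y ∂ν‖ₑ ≤ ∫⁻ y, ‖u y‖ₑ ∂ν := enorm_integral_le_lintegral_enorm _
    _ = eLpNorm u 1 ν := eLpNorm_one_eq_lintegral_enorm.symm
    _ ≤ eLpNorm u (ENNReal.ofReal p) ν :=
        eLpNorm_le_eLpNorm_of_exponent_le (by simpa using hp) huν
    _ = (volume A)⁻¹ ^ (1 / p) * eLpNorm u (ENNReal.ofReal p) (volume.restrict A) := by
        rw [hν, eLpNorm_smul_measure_of_ne_top ENNReal.ofReal_ne_top, smul_eq_mul,
          ENNReal.toReal_div, ENNReal.toReal_one, ENNReal.toReal_ofReal hp0.le]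
    _ ≤ _ := by
        refine mul_le_mul' ?_ (eLpNorm_mono_measure _ (Measure.restrict_mono_set _ inter_subset_left))
        refine (ENNReal.rpow_le_rpow hV (by positivity)).trans (le_of_eq ?_)
        rw [ENNReal.ofReal_rpow_of_pos (by positivity)]
        congr 1
        rw [mul_inv, Real.mul_rpow (by positivity) (by positivity), ← Real.rpow_neg_one c,
          ← Real.rpow_mul hc.le, ← Real.rpow_neg hr.le, ← Real.rpow_mul hr.le]
        congr 2 <;> ring

/-- Hedberg's trick: if `a` can be approximated at every scale `r ≤ r₀` by some `m` of size at most
`A r ^ (-n / p)` with error at most `(K r ^ (2s) G) ^ (1 / 2)`, then the scale at which the first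
quantity is `|a| / 2` gives the best information on `|a|`. -/
lemma abs_rpow_le_of_approx {n p s r₀ A K G a : ℝ} (hn : 0 < n) (hp : 0 < p) (hs : 0 < s)
    (hr₀ : 0 < r₀) (hA : 0 < A) (hK : 0 ≤ K) (hG : 0 ≤ G)
    (h : ∀ r, 0 < r → r ≤ r₀ →
      ∃ m, |m| ≤ A * r ^ (-(n / p)) ∧ (a - m) ^ 2 ≤ K * r ^ (2 * s) * G) :
    |a| ^ (2 + 2 * s * p / n) ≤ (2 * A * r₀ ^ (-(n / p))) ^ (2 + 2 * s * p / n) +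
      4 * K * (2 * A) ^ (2 * s * p / n) * G := by
  rcases le_or_gt |a| (2 * A * r₀ ^ (-(n / p))) with ha | ha
  · have h1 : |a| ^ (2 + 2 * s * p / n) ≤ (2 * A * r₀ ^ (-(n / p))) ^ (2 + 2 * s * p / n) := by
      gcongr
    have h2 : 0 ≤ 4 * K * (2 * A) ^ (2 * s * p / n) * G := by positivity
    linarith
  · have ha0 : 0 < |a| := lt_trans (by positivity) ha
    set r := (2 * A / |a|) ^ (p / n) with hr
    have hr0 : 0 < r := by positivity
    have hrr : r ≤ r₀ := by
      have h1 : 2 * A / |a| ≤ r₀ ^ (n / p) := by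
        rw [div_le_iff₀ ha0]
        rw [Real.rpow_neg hr₀.le, ← div_eq_mul_inv, div_lt_iff₀ (by positivity)] at ha
        linarith
      calc r ≤ (r₀ ^ (n / p)) ^ (p / n) := by rw [hr]; gcongr
        _ = r₀ := by
          rw [← Real.rpow_mul hr₀.le, div_mul_div_cancel₀ hp.ne', div_self hn.ne', Real.rpow_one]
    obtain ⟨m, hm, ham⟩ := h r hr0 hrr
    have hrn : r ^ (-(n / p)) = |a| / (2 * A) := by
      rw [hr, ← Real.rpow_mul (by positivity)]
      have : p / n * -(n / p) = -1 := by field_simp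
      rw [this, Real.rpow_neg_one, inv_div]
    have hm' : |m| ≤ |a| / 2 := by
      rw [hrn] at hm
      refine hm.trans (le_of_eq ?_)
      field_simp
    have h1 : |a| / 2 ≤ |a - m| := by
      have := abs_sub_abs_le_abs_sub a m
      linarith
    have h2 : |a| ^ 2 ≤ 4 * (K * r ^ (2 * s) * G) := by
      have : (|a| / 2) ^ 2 ≤ |a - m| ^ 2 := by gcongr
      rw [sq_abs] at this
      nlinarith
    have hrs : r ^ (2 * s) * |a| ^ (2 * s * p / n) = (2 * A) ^ (2 * s * p / n) := by
      rw [hr, ← Real.rpow_mul (by positivity), show p / n * (2 * s) = 2 * s * p / n by ring,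
        ← Real.mul_rpow (by positivity) (by positivity), div_mul_cancel₀ _ ha0.ne']
    calc |a| ^ (2 + 2 * s * p / n) = |a| ^ 2 * |a| ^ (2 * s * p / n) := by
          rw [Real.rpow_add ha0]; norm_cast
      _ ≤ 4 * (K * r ^ (2 * s) * G) * |a| ^ (2 * s * p / n) := by gcongr
      _ = 4 * K * (r ^ (2 * s) * |a| ^ (2 * s * p / n)) * G := by ring
      _ = 4 * K * (2 * A) ^ (2 * s * p / n) * G := by rw [hrs]
      _ ≤ _ := le_add_of_nonneg_left (by positivity)

/-! ### The fractional Sobolev inequality by bootstrapping -/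

lemma eLpNorm_ofReal_rpow_eq_lintegral {α : Type*} [MeasurableSpace α] {ν : Measure α} {p : ℝ}
    (hp : 0 < p) (f : α → ℝ) :
    eLpNorm f (ENNReal.ofReal p) ν ^ p = ∫⁻ x, ‖f x‖ₑ ^ p ∂ν := by
  rw [eLpNorm_eq_lintegral_rpow_enorm_toReal (ENNReal.ofReal_pos.2 hp).ne' ENNReal.ofReal_ne_top,
    ENNReal.toReal_ofReal hp.le, ← ENNReal.rpow_mul, one_div_mul_cancel hp.ne', ENNReal.rpow_one]

lemma HsNorm_rpow_two (s : ℝ) (u : EuclideanSpace ℝ (Fin N) → ℝ) :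
    HsNorm Ω s u ^ (2 : ℝ) =
      eLpNorm u 2 (volume.restrict Ω) ^ 2 + gagliardo N s (Ω ×ˢ Ω) u := by
  rw [HsNorm, ← ENNReal.rpow_mul]
  norm_num

lemma eLpNorm_two_le_HsNorm (s : ℝ) (u : EuclideanSpace ℝ (Fin N) → ℝ) :
    eLpNorm u 2 (volume.restrict Ω) ≤ HsNorm Ω s u := by
  have h : eLpNorm u 2 (volume.restrict Ω) ^ (2 : ℝ) ≤ HsNorm Ω s u ^ (2 : ℝ) := by
    rw [HsNorm_rpow_two, ENNReal.rpow_two]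
    exact le_self_add
  exact (ENNReal.rpow_le_rpow_iff two_pos).1 h

lemma gagliardo_le_HsNorm (s : ℝ) (u : EuclideanSpace ℝ (Fin N) → ℝ) :
    gagliardo N s (Ω ×ˢ Ω) u ≤ HsNorm Ω s u ^ (2 : ℝ) := by
  rw [HsNorm_rpow_two]
  exact le_add_self

lemma integrableOn_of_mem_HsSpace (hΩb : Bornology.IsBounded Ω) {s : ℝ}
    {u : EuclideanSpace ℝ (Fin N) → ℝ} (hu : u ∈ HsSpace Ω s) : IntegrableOn u Ω := by
  have : IsFiniteMeasure (volume.restrict Ω) :=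
    ⟨by rw [Measure.restrict_apply_univ]; exact hΩb.measure_lt_top⟩
  exact MemLp.integrable one_le_two
    ⟨hu.1.aestronglyMeasurable, (eLpNorm_two_le_HsNorm s u).trans_lt hu.2⟩

lemma gagliardo_const_smul (s t : ℝ) (A : Set (EuclideanSpace ℝ (Fin N) × EuclideanSpace ℝ (Fin N)))
    (u : EuclideanSpace ℝ (Fin N) → ℝ) :
    gagliardo N s A (t • u) = ENNReal.ofReal (t ^ 2) * gagliardo N s A u := by
  unfold gagliardo
  rw [← lintegral_const_mul' _ _ ENNReal.ofReal_ne_top]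
  refine lintegral_congr fun p => ?_
  rw [← ENNReal.ofReal_mul (by positivity)]
  congr 1
  simp only [Pi.smul_apply, smul_eq_mul]
  rw [← mul_sub, abs_mul, mul_pow, sq_abs, mul_div_assoc]

lemma HsNorm_const_smul (s t : ℝ) (u : EuclideanSpace ℝ (Fin N) → ℝ) :
    HsNorm Ω s (t • u) = ‖t‖ₑ * HsNorm Ω s u := by
  have ht : ENNReal.ofReal (t ^ 2) = ‖t‖ₑ ^ 2 := by
    rw [Real.enorm_eq_ofReal_abs, ← ENNReal.ofReal_pow (abs_nonneg t), sq_abs]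
  unfold HsNorm
  rw [gagliardo_const_smul, eLpNorm_const_smul, mul_pow, ht, ← mul_add,
    ENNReal.mul_rpow_of_nonneg _ _ (by norm_num), ← ENNReal.rpow_natCast, ← ENNReal.rpow_mul]
  norm_num

/-- The unit ball of `H^s(Ω)` is bounded in `L^p(Ω)`. -/
def SobolevBound (Ω : Set (EuclideanSpace ℝ (Fin N))) (s p : ℝ) : Prop :=
  ∃ C : ℝ≥0, ∀ u : EuclideanSpace ℝ (Fin N) → ℝ, AEMeasurable u (volume.restrict Ω) →
    HsNorm Ω s u ≤ 1 → eLpNorm u (ENNReal.ofReal p) (volume.restrict Ω) ≤ C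

lemma sobolevBound_two (s : ℝ) : SobolevBound Ω s 2 :=
  ⟨1, fun u _ hu => by simpa using (eLpNorm_two_le_HsNorm s u).trans hu⟩

lemma SobolevBound.exists_forall_le {s p : ℝ} (h : SobolevBound Ω s p) :
    ∃ C : ℝ≥0, ∀ u ∈ HsSpace Ω s,
      eLpNorm u (ENNReal.ofReal p) (volume.restrict Ω) ≤ C * HsNorm Ω s u := by
  obtain ⟨C, hC⟩ := h
  have scaled : ∀ u ∈ HsSpace Ω s, ∀ t : ℝ≥0, 0 < t → HsNorm Ω s u ≤ t →
      eLpNorm u (ENNReal.ofReal p) (volume.restrict Ω) ≤ C * t := by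
    intro u hu t ht hut
    have htt : ‖((t⁻¹ : ℝ≥0) : ℝ)‖ₑ = (t : ℝ≥0∞)⁻¹ := by
      rw [Real.enorm_eq_ofReal (NNReal.coe_nonneg _), ENNReal.ofReal_coe_nnreal, ENNReal.coe_inv ht.ne']
    have ht0 : (t : ℝ≥0∞) ≠ 0 := by exact_mod_cast ht.ne'
    have h1 := hC (((t⁻¹ : ℝ≥0) : ℝ) • u) (hu.1.const_smul _) (by
      rw [HsNorm_const_smul, htt]
      calc (t : ℝ≥0∞)⁻¹ * HsNorm Ω s u ≤ (t : ℝ≥0∞)⁻¹ * t := by gcongr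
        _ = 1 := ENNReal.inv_mul_cancel ht0 ENNReal.coe_ne_top)
    rw [eLpNorm_const_smul, htt] at h1
    calc eLpNorm u (ENNReal.ofReal p) (volume.restrict Ω)
        = ((t : ℝ≥0∞)⁻¹ * eLpNorm u (ENNReal.ofReal p) (volume.restrict Ω)) * t := by
          rw [mul_right_comm, ENNReal.inv_mul_cancel ht0 ENNReal.coe_ne_top, one_mul]
      _ ≤ C * t := by gcongr
  refine ⟨C, fun u hu => ENNReal.le_of_forall_pos_le_add fun ε hε _ => ?_⟩
  -- a slightly larger radius, since the norm of `u` may vanish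
  set δ : ℝ≥0 := ε / (C + 1) with hδ
  have hδ0 : 0 < δ := by positivity
  have hsum : HsNorm Ω s u ≤ (((HsNorm Ω s u).toNNReal + δ : ℝ≥0) : ℝ≥0∞) := by
    rw [ENNReal.coe_add, ENNReal.coe_toNNReal hu.2.ne]
    exact le_self_add
  refine (scaled u hu _ (by positivity) hsum).trans ?_
  rw [ENNReal.coe_add, ENNReal.coe_toNNReal hu.2.ne, mul_add]
  gcongr
  rw [← ENNReal.coe_mul]
  have : C * δ ≤ ε := by
    rw [hδ, ← mul_div_assoc]
    refine div_le_of_le_mul₀ (by positivity) (by positivity) ?_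
    rw [mul_comm]
    gcongr
    exact le_self_add
  exact_mod_cast this

/-- One step of the bootstrap: an `L^p` bound improves to an `L^(2 + 2sp/N)` bound. -/
lemma SobolevBound.step {c r₀ s p : ℝ} (hN : 1 ≤ N) (hc : 0 < c) (hr₀ : 0 < r₀) (hs : 0 < s)
    (hΩo : IsOpen Ω) (hΩb : Bornology.IsBounded Ω) (hd : MeasureDensity Ω c r₀) (hp : 1 ≤ p)
    (h : SobolevBound Ω s p) : SobolevBound Ω s (2 + 2 * s * p / N) := by
  obtain ⟨C, hC⟩ := h
  have hN0 : (0 : ℝ) < N := by exact_mod_cast hN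
  have hp0 : 0 < p := by linarith
  set P := 2 + 2 * s * p / N with hP
  have hP0 : 0 < P := by positivity
  set A : ℝ := c ^ (-(1 / p)) * (C + 1) with hA
  set K : ℝ := 2 ^ ((N : ℝ) + 2 * s) / c with hK
  have hK0 : 0 < K := by positivity
  have hA0 : 0 < A := by positivity
  set T₁ : ℝ := (2 * A * r₀ ^ (-((N : ℝ) / p))) ^ P with hT₁
  set T₂ : ℝ := 4 * K * (2 * A) ^ (2 * s * p / N) with hT₂
  have hT₁0 : 0 ≤ T₁ := by positivity
  have hT₂0 : 0 < T₂ := by positivity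
  have hfin : ENNReal.ofReal T₁ * volume Ω + ENNReal.ofReal T₂ ≠ ∞ :=
    ENNReal.add_ne_top.2 ⟨ENNReal.mul_ne_top ENNReal.ofReal_ne_top hΩb.measure_lt_top.ne,
      ENNReal.ofReal_ne_top⟩
  refine ⟨((ENNReal.ofReal T₁ * volume Ω + ENNReal.ofReal T₂) ^ (1 / P)).toNNReal,
    fun u hu hu1 => ?_⟩
  have hmem : u ∈ HsSpace Ω s := ⟨hu, hu1.trans_lt ENNReal.one_lt_top⟩
  have hint := integrableOn_of_mem_HsSpace hΩb hmem
  have hLp := hC u hu hu1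
  have hgag : gagliardo N s (Ω ×ˢ Ω) u ≤ 1 := by
    simpa using (gagliardo_le_HsNorm s u).trans (ENNReal.rpow_le_rpow hu1 zero_le_two)
  have hpt : ∀ x ∈ Ω, ‖u x‖ₑ ^ P ≤
      ENNReal.ofReal T₁ + ENNReal.ofReal T₂ * localEnergy Ω s u x := by
    intro x hx
    by_cases hG : localEnergy Ω s u x = ∞
    · rw [hG, ENNReal.mul_top (ENNReal.ofReal_pos.2 hT₂0).ne', add_top]
      exact le_top
    have happ := abs_rpow_le_of_approx (a := u x) hN0 hp0 hs hr₀ hA0 hK0.le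
      (ENNReal.toReal_nonneg (a := localEnergy Ω s u x)) fun r hr hrr => by
        refine ⟨⨍ y in Ω ∩ Metric.ball x r, u y, ?_, ?_⟩
        · have h1 := (enorm_average_le hc hp hd hu.aestronglyMeasurable hx hr hrr).trans
            (mul_le_mul_right (hLp.trans (le_self_add (b := (1 : ℝ≥0∞)))) _)
          rw [Real.enorm_eq_ofReal_abs, ← ENNReal.coe_one, ← ENNReal.coe_add,
            ← ENNReal.ofReal_coe_nnreal, ← ENNReal.ofReal_mul (by positivity),
            ENNReal.ofReal_le_ofReal_iff (by positivity)] at h1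
          refine h1.trans (le_of_eq ?_)
          rw [hA]
          push_cast
          ring
        · have h1 := enorm_sub_average_sq_le hc hs hΩo hd hint (x := x) hx hr hrr
            (by simpa using hr)
          rw [Real.enorm_eq_ofReal_abs, ← ENNReal.ofReal_pow (abs_nonneg _), sq_abs,
            ← ENNReal.ofReal_toReal hG, ← ENNReal.ofReal_mul (by positivity),
            ENNReal.ofReal_le_ofReal_iff (by positivity)] at h1
          exact h1
    rw [Real.enorm_eq_ofReal_abs, ENNReal.ofReal_rpow_of_nonneg (abs_nonneg _) hP0.le]
    refine (ENNReal.ofReal_le_ofReal happ).trans (le_of_eq ?_)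
    rw [ENNReal.ofReal_add hT₁0 (by positivity), ENNReal.ofReal_mul hT₂0.le,
      ENNReal.ofReal_toReal hG]
  have hlint : eLpNorm u (ENNReal.ofReal P) (volume.restrict Ω) ^ P ≤
      ENNReal.ofReal T₁ * volume Ω + ENNReal.ofReal T₂ := by
    rw [eLpNorm_ofReal_rpow_eq_lintegral hP0]
    calc ∫⁻ x in Ω, ‖u x‖ₑ ^ P
        ≤ ∫⁻ x in Ω, (ENNReal.ofReal T₁ + ENNReal.ofReal T₂ * localEnergy Ω s u x) :=
          setLIntegral_mono' hΩo.measurableSet hpt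
      _ = ENNReal.ofReal T₁ * volume Ω + ENNReal.ofReal T₂ * gagliardo N s (Ω ×ˢ Ω) u := by
          rw [lintegral_add_left measurable_const, lintegral_const, Measure.restrict_apply_univ,
            lintegral_const_mul' _ _ ENNReal.ofReal_ne_top, lintegral_localEnergy hu]
      _ ≤ _ := by
          gcongr
          exact mul_le_of_le_one_right' hgag
  rw [ENNReal.coe_toNNReal (ENNReal.rpow_ne_top_of_nonneg (by positivity) hfin)]
  calc eLpNorm u (ENNReal.ofReal P) (volume.restrict Ω)
      = (eLpNorm u (ENNReal.ofReal P) (volume.restrict Ω) ^ P) ^ (1 / P) := by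
        rw [← ENNReal.rpow_mul, mul_one_div_cancel hP0.ne', ENNReal.rpow_one]
    _ ≤ _ := ENNReal.rpow_le_rpow hlint (by positivity)

lemma lt_two_add_of_lt_critExp {s q : ℝ} (hN : 1 ≤ N)
    (hq : ENNReal.ofReal q < critExp N s) (hq0 : 0 ≤ q) : q < 2 + 2 * s * q / N := by
  have hN0 : (0 : ℝ) < N := by exact_mod_cast hN
  have key : (N - 2 * s) * q < 2 * N := by
    unfold critExp at hq
    split_ifs at hq with h
    · have hd : 0 < (N : ℝ) - 2 * s := by linarith
      rw [ENNReal.ofReal_lt_ofReal_iff (by positivity), lt_div_iff₀ hd] at hq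
      linarith
    · push Not at h
      nlinarith
  rw [← sub_lt_iff_lt_add', lt_div_iff₀ hN0]
  linarith

/-- The exponents `p₀ = 2`, `p_{k+1} = 2 + 2 s p_k / N` of the bootstrap increase by a fixed amount
as long as they stay below a given subcritical `q`, so that they exceed it eventually. -/
lemma exists_sobolevBound_gt {c r₀ s q : ℝ} (hN : 1 ≤ N) (hc : 0 < c) (hr₀ : 0 < r₀) (hs : 0 < s)
    (hΩo : IsOpen Ω) (hΩb : Bornology.IsBounded Ω) (hd : MeasureDensity Ω c r₀) (hq2 : 2 ≤ q)
    (hq : ENNReal.ofReal q < critExp N s) :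
    ∃ p, q < p ∧ SobolevBound Ω s p := by
  have hN0 : (0 : ℝ) < N := by exact_mod_cast hN
  have hlt := lt_two_add_of_lt_critExp hN hq (by linarith)
  by_contra! hcon
  set δ := min (2 + 2 * s * q / N - q) (2 * s * 2 / N) with hδ
  have hδ0 : 0 < δ := lt_min (by linarith) (by positivity)
  have hiter : ∀ k : ℕ, ∃ p, 2 ≤ p ∧ 2 + k * δ ≤ p ∧ SobolevBound Ω s p := by
    intro k
    induction k with
    | zero => exact ⟨2, le_rfl, by simp, sobolevBound_two s⟩
    | succ k ih =>
      obtain ⟨p, hp2, hpk, hp⟩ := ih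
      have hpq : p ≤ q := not_lt.1 fun h => hcon p h hp
      have h0 : 0 ≤ 2 * s * p / N := by positivity
      refine ⟨2 + 2 * s * p / N, by linarith, ?_, hp.step hN hc hr₀ hs hΩo hΩb hd (by linarith)⟩
      -- the gain `2 + 2 s p / N - p` is affine in `p`, hence at least its value at `2` or at `q`
      have hgain : δ ≤ 2 + 2 * s * p / N - p := by
        set θ := 2 * s / N with hθ
        have e1 : 2 * s * p / N = θ * p := by rw [hθ]; ring
        have e2 : 2 * s * q / N = θ * q := by rw [hθ]; ring
        have e3 : 2 * s * 2 / N = θ * 2 := by rw [hθ]; ring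
        rw [e1]
        rw [e2, e3] at hδ
        rcases le_total θ 1 with hθ1 | hθ1
        · have := min_le_left (2 + θ * q - q) (θ * 2)
          nlinarith
        · have := min_le_right (2 + θ * q - q) (θ * 2)
          nlinarith
      push_cast
      linarith
  obtain ⟨k, hk⟩ := exists_nat_gt (q / δ)
  obtain ⟨p, _, hpk, hp⟩ := hiter k
  rw [div_lt_iff₀ hδ0] at hk
  exact hcon p (by linarith) hp

/-! ### Compactness in `L²` -/

lemma enorm_add_sq_le (a b : ℝ) : ‖a + b‖ₑ ^ 2 ≤ 2 * ‖a‖ₑ ^ 2 + 2 * ‖b‖ₑ ^ 2 := by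
  have h : ∀ t : ℝ, ‖t‖ₑ ^ 2 = ENNReal.ofReal (t ^ 2) := fun t => by
    rw [Real.enorm_eq_ofReal_abs, ← ENNReal.ofReal_pow (abs_nonneg t), sq_abs]
  have h2 : (2 : ℝ≥0∞) = ENNReal.ofReal 2 := by simp
  rw [h, h, h, h2, ← ENNReal.ofReal_mul zero_le_two, ← ENNReal.ofReal_mul zero_le_two,
    ← ENNReal.ofReal_add (by positivity) (by positivity)]
  exact ENNReal.ofReal_le_ofReal (by nlinarith [sq_nonneg (a - b)])

lemma eLpNorm_two_sq_eq_lintegral {α : Type*} [MeasurableSpace α] {ν : Measure α} (f : α → ℝ) :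
    eLpNorm f 2 ν ^ 2 = ∫⁻ x, ‖f x‖ₑ ^ 2 ∂ν := by
  have := eLpNorm_ofReal_rpow_eq_lintegral (ν := ν) two_pos f
  simpa using this

lemma gagliardo_sub_le {s : ℝ} {u v : EuclideanSpace ℝ (Fin N) → ℝ}
    (hu : AEMeasurable u (volume.restrict Ω)) :
    gagliardo N s (Ω ×ˢ Ω) (u - v) ≤
      2 * gagliardo N s (Ω ×ˢ Ω) u + 2 * gagliardo N s (Ω ×ˢ Ω) v := by
  have hmeas := aemeasurable_gagliardo_integrand (s := s) hu
  rw [Measure.prod_restrict, ← Measure.volume_eq_prod] at hmeas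
  have h2 : ∀ t : ℝ, 2 * ENNReal.ofReal t = ENNReal.ofReal (2 * t) := fun t => by
    rw [ENNReal.ofReal_mul zero_le_two, ENNReal.ofReal_ofNat]
  unfold gagliardo
  rw [← lintegral_const_mul' _ _ ENNReal.ofNat_ne_top,
    ← lintegral_const_mul' _ _ ENNReal.ofNat_ne_top, ← lintegral_add_left' (hmeas.const_mul _)]
  refine lintegral_mono fun p => ?_
  rw [h2, h2, ← ENNReal.ofReal_add (by positivity) (by positivity)]
  refine ENNReal.ofReal_le_ofReal ?_
  rw [← mul_div_assoc, ← mul_div_assoc, ← add_div]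
  gcongr
  simp only [sq_abs, Pi.sub_apply]
  nlinarith [sq_nonneg ((u p.1 - u p.2) + (v p.1 - v p.2))]

lemma HsNorm_sub_le {s : ℝ} {u v : EuclideanSpace ℝ (Fin N) → ℝ} {M : ℝ≥0∞}
    (hu : AEMeasurable u (volume.restrict Ω))
    (huM : HsNorm Ω s u ≤ M) (hvM : HsNorm Ω s v ≤ M) : HsNorm Ω s (u - v) ≤ 2 * M := by
  refine (ENNReal.rpow_le_rpow_iff two_pos).1 ?_
  have h1 : eLpNorm (u - v) 2 (volume.restrict Ω) ^ 2 ≤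
      2 * eLpNorm u 2 (volume.restrict Ω) ^ 2 + 2 * eLpNorm v 2 (volume.restrict Ω) ^ 2 := by
    simp only [eLpNorm_two_sq_eq_lintegral]
    rw [← lintegral_const_mul' _ _ ENNReal.ofNat_ne_top,
      ← lintegral_const_mul' _ _ ENNReal.ofNat_ne_top,
      ← lintegral_add_left' ((hu.enorm.pow_const 2).const_mul _)]
    refine lintegral_mono fun x => ?_
    simpa [sub_eq_add_neg] using enorm_add_sq_le (u x) (-v x)
  calc HsNorm Ω s (u - v) ^ (2 : ℝ)
      ≤ 2 * HsNorm Ω s u ^ (2 : ℝ) + 2 * HsNorm Ω s v ^ (2 : ℝ) := by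
        simp only [HsNorm_rpow_two]
        refine (add_le_add h1 (gagliardo_sub_le hu)).trans (le_of_eq ?_)
        ring
    _ ≤ 2 * M ^ (2 : ℝ) + 2 * M ^ (2 : ℝ) := by gcongr
    _ = (2 * M) ^ (2 : ℝ) := by
        simp only [ENNReal.rpow_two]
        ring

/-- Up to an error of order `r ^ (2s)`, the `L²` norm on `Ω` is controlled by the averages over the
finitely many sets `Ω ∩ B(z, r)` of a covering of `Ω`. -/
lemma eLpNorm_two_sq_le_of_cover {c r₀ s : ℝ} (hc : 0 < c) (hs : 0 < s) (hΩo : IsOpen Ω)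
    (hΩb : Bornology.IsBounded Ω) (hd : MeasureDensity Ω c r₀)
    {v : EuclideanSpace ℝ (Fin N) → ℝ} (hv : v ∈ HsSpace Ω s) {r : ℝ} (hr : 0 < r) (hrr : r ≤ r₀)
    {t : Finset (EuclideanSpace ℝ (Fin N))} (htΩ : ∀ z ∈ t, z ∈ Ω)
    (hcov : ∀ x ∈ Ω, ∃ z ∈ t, dist x z < r) :
    eLpNorm v 2 (volume.restrict Ω) ^ 2 ≤
      2 * ENNReal.ofReal (2 ^ ((N : ℝ) + 2 * s) / c * r ^ (2 * s)) * gagliardo N s (Ω ×ˢ Ω) v +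
        2 * volume Ω * ∑ z ∈ t, ‖⨍ y in Ω ∩ Metric.ball z r, v y‖ₑ ^ 2 := by
  have hint := integrableOn_of_mem_HsSpace hΩb hv
  set κ := ENNReal.ofReal (2 ^ ((N : ℝ) + 2 * s) / c * r ^ (2 * s)) with hκ
  have hκt : 2 * κ ≠ ∞ := ENNReal.mul_ne_top ENNReal.ofNat_ne_top ENNReal.ofReal_ne_top
  rw [eLpNorm_two_sq_eq_lintegral]
  calc ∫⁻ x in Ω, ‖v x‖ₑ ^ 2
      ≤ ∫⁻ x in Ω, (2 * κ * localEnergy Ω s v x +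
          2 * ∑ z ∈ t, ‖⨍ y in Ω ∩ Metric.ball z r, v y‖ₑ ^ 2) := by
        refine setLIntegral_mono' hΩo.measurableSet fun x hx => ?_
        obtain ⟨z, hzt, hxz⟩ := hcov x hx
        have h1 := enorm_add_sq_le (v x - ⨍ y in Ω ∩ Metric.ball z r, v y)
          (⨍ y in Ω ∩ Metric.ball z r, v y)
        rw [sub_add_cancel] at h1
        refine h1.trans (add_le_add ?_ ?_)
        · rw [mul_assoc]
          gcongr
          exact enorm_sub_average_sq_le hc hs hΩo hd hint (htΩ z hzt) hr hrr hxz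
        · gcongr
          exact Finset.single_le_sum
            (f := fun z => ‖⨍ y in Ω ∩ Metric.ball z r, v y‖ₑ ^ 2) (fun _ _ => zero_le) hzt
    _ = _ := by
        rw [lintegral_add_right _ measurable_const, lintegral_const, Measure.restrict_apply_univ,
          lintegral_const_mul' _ _ hκt, lintegral_localEnergy hv.1]
        ring

/-- A bounded sequence of `H^s(Ω)` has a subsequence which is Cauchy in `L²(Ω)`: along a
subsequence, all the averages over countably many coverings by smaller and smaller balls
converge. -/
lemma exists_subseq_cauchy_two {c r₀ s : ℝ} (hc : 0 < c) (hr₀ : 0 < r₀) (hs : 0 < s)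
    (hΩo : IsOpen Ω) (hΩb : Bornology.IsBounded Ω) (hd : MeasureDensity Ω c r₀)
    {u : ℕ → EuclideanSpace ℝ (Fin N) → ℝ} (hu : ∀ n, u n ∈ HsSpace Ω s) {M : ℝ≥0}
    (hM : ∀ n, HsNorm Ω s (u n) ≤ M) :
    ∃ φ : ℕ → ℕ, StrictMono φ ∧ Tendsto (fun k : ℕ × ℕ =>
      eLpNorm (u (φ k.1) - u (φ k.2)) 2 (volume.restrict Ω)) atTop (𝓝 0) := by
  set ρ : ℕ → ℝ := fun k => r₀ / (k + 1) with hρ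
  have hρ0 : ∀ k, 0 < ρ k := fun k => by positivity
  have hρr : ∀ k, ρ k ≤ r₀ := fun k => div_le_self hr₀.le (by simp)
  have hρlim : Tendsto ρ atTop (𝓝 0) := by
    have := (tendsto_one_div_add_atTop_nhds_zero_nat (𝕜 := ℝ)).const_mul r₀
    rw [mul_zero] at this
    exact this.congr fun k => by rw [hρ]; ring
  have htb : TotallyBounded Ω := hΩb.isCompact_closure.totallyBounded.subset subset_closure
  have hnet : ∀ k, ∃ t : Finset (EuclideanSpace ℝ (Fin N)), (∀ z ∈ t, z ∈ Ω) ∧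
      ∀ x ∈ Ω, ∃ z ∈ t, dist x z < ρ k := fun k => by
    obtain ⟨t, htΩ, htf, hcov⟩ := Metric.finite_approx_of_totallyBounded htb (ρ k) (hρ0 k)
    refine ⟨htf.toFinset, fun z hz => htΩ (by simpa using hz), fun x hx => ?_⟩
    simpa using hcov hx
  choose t htΩ hcov using hnet
  set avg : ℕ → (Σ k, t k) → ℝ := fun n i => ⨍ y in Ω ∩ Metric.ball i.2.1 (ρ i.1), u n y with havg
  have hbdd : ∀ i : Σ k, t k, ∃ B, ∀ n, |avg n i| ≤ B := by
    intro i
    refine ⟨(c ^ (-(1 / 2) : ℝ) * ρ i.1 ^ (-((N : ℝ) / 2))) * M, fun n => ?_⟩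
    have h1 := enorm_average_le (p := 2) hc one_le_two hd (hu n).1.aestronglyMeasurable
      (htΩ i.1 i.2.1 i.2.2) (hρ0 i.1) (hρr i.1)
    have h2 : eLpNorm (u n) (ENNReal.ofReal 2) (volume.restrict Ω) ≤ M := by
      simpa using (eLpNorm_two_le_HsNorm s (u n)).trans (hM n)
    have h3 := h1.trans (mul_le_mul_right h2 _)
    have hpos : 0 ≤ c ^ (-(1 / 2) : ℝ) * ρ i.1 ^ (-((N : ℝ) / 2)) :=
      mul_nonneg (Real.rpow_nonneg hc.le _) (Real.rpow_nonneg (hρ0 _).le _)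
    rw [Real.enorm_eq_ofReal_abs, ← ENNReal.ofReal_coe_nnreal, ← ENNReal.ofReal_mul hpos] at h3
    exact (ENNReal.ofReal_le_ofReal_iff (mul_nonneg hpos M.coe_nonneg)).1 h3
  choose B hB using hbdd
  obtain ⟨a, -, φ, hφ, hlim⟩ :=
    (isCompact_univ_pi fun i => isCompact_Icc (a := -B i) (b := B i)).tendsto_subseq
      (x := avg) fun n i _ => abs_le.1 (hB i n)
  refine ⟨φ, hφ, ?_⟩
  have hlim' := tendsto_pi_nhds.1 hlim
  have hdiff : ∀ i, Tendsto (fun k : ℕ × ℕ => avg (φ k.1) i - avg (φ k.2) i) atTop (𝓝 0) := by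
    intro i
    have h1 := (hlim' i).comp (tendsto_fst (f := atTop) (g := (atTop : Filter ℕ)))
    have h2 := (hlim' i).comp (tendsto_snd (f := (atTop : Filter ℕ)) (g := atTop))
    have h3 := h1.sub h2
    rw [sub_self, prod_atTop_atTop_eq] at h3
    exact h3
  have hsub : ∀ n m i, (⨍ y in Ω ∩ Metric.ball i.2.1 (ρ i.1), (u n - u m) y) =
      avg n i - avg m i := by
    intro n m i
    have hn := (integrableOn_of_mem_HsSpace hΩb (hu n)).mono_set
      (inter_subset_left (t := Metric.ball i.2.1 (ρ i.1)))
    have hm := (integrableOn_of_mem_HsSpace hΩb (hu m)).mono_set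
      (inter_subset_left (t := Metric.ball i.2.1 (ρ i.1)))
    simp only [havg, setAverage_eq, Pi.sub_apply]
    rw [integral_sub hn hm, smul_sub]
  have hmemsub : ∀ n m, HsNorm Ω s (u n - u m) ≤ 2 * M :=
    fun n m => HsNorm_sub_le (hu n).1 (hM n) (hM m)
  set κ : ℕ → ℝ≥0∞ := fun k =>
    2 * ENNReal.ofReal (2 ^ ((N : ℝ) + 2 * s) / c * ρ k ^ (2 * s)) * (2 * M) ^ (2 : ℝ) with hκ
  have hκlim : Tendsto κ atTop (𝓝 0) := by
    have h1 : Tendsto (fun k => ρ k ^ (2 * s)) atTop (𝓝 0) := by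
      have := hρlim.rpow_const (p := 2 * s) (Or.inr (by positivity))
      rwa [Real.zero_rpow (by positivity)] at this
    have h2 := ENNReal.tendsto_ofReal (h1.const_mul (2 ^ ((N : ℝ) + 2 * s) / c))
    rw [mul_zero, ENNReal.ofReal_zero] at h2
    have h3 := ENNReal.Tendsto.mul_const (b := (2 * M : ℝ≥0∞) ^ (2 : ℝ))
      (ENNReal.Tendsto.const_mul (a := 2) h2 (Or.inr ENNReal.ofNat_ne_top))
      (Or.inr (ENNReal.rpow_ne_top_of_nonneg zero_le_two
        (ENNReal.mul_ne_top ENNReal.ofNat_ne_top ENNReal.coe_ne_top)))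
    rwa [mul_zero, zero_mul] at h3
  have hsq : Tendsto (fun k : ℕ × ℕ =>
      eLpNorm (u (φ k.1) - u (φ k.2)) 2 (volume.restrict Ω) ^ 2) atTop (𝓝 0) := by
    rw [ENNReal.tendsto_nhds_zero]
    intro ε hε
    have hε2 : 0 < ε / 2 := ENNReal.half_pos hε.ne'
    obtain ⟨k, hk⟩ := ((ENNReal.tendsto_nhds_zero.1 hκlim) _ hε2).exists
    have hsum : Tendsto (fun n : ℕ × ℕ => 2 * volume Ω *
        ∑ z ∈ (t k).attach, ‖avg (φ n.1) ⟨k, z⟩ - avg (φ n.2) ⟨k, z⟩‖ₑ ^ 2) atTop (𝓝 0) := by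
      have h1 : Tendsto (fun n : ℕ × ℕ =>
          ∑ z ∈ (t k).attach, ‖avg (φ n.1) ⟨k, z⟩ - avg (φ n.2) ⟨k, z⟩‖ₑ ^ 2) atTop
          (𝓝 (∑ z ∈ (t k).attach, (0 : ℝ≥0∞))) := by
        refine tendsto_finsetSum _ fun z _ => ?_
        have h2 := ENNReal.Tendsto.pow (n := 2) (hdiff ⟨k, z⟩).enorm
        simpa using h2
      rw [Finset.sum_const_zero] at h1
      have h2 := ENNReal.Tendsto.const_mul (a := 2 * volume Ω) h1
        (Or.inr (ENNReal.mul_ne_top ENNReal.ofNat_ne_top hΩb.measure_lt_top.ne))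
      rwa [mul_zero] at h2
    filter_upwards [(ENNReal.tendsto_nhds_zero.1 hsum) _ hε2] with n hn
    have hv : u (φ n.1) - u (φ n.2) ∈ HsSpace Ω s :=
      ⟨(hu _).1.sub (hu _).1, (hmemsub _ _).trans_lt
        (ENNReal.mul_lt_top ENNReal.ofNat_lt_top ENNReal.coe_lt_top)⟩
    have h1 := eLpNorm_two_sq_le_of_cover hc hs hΩo hΩb hd hv (hρ0 k) (hρr k) (htΩ k) (hcov k)
    rw [← Finset.sum_attach] at h1
    calc _ ≤ _ := h1
      _ ≤ ε / 2 + ε / 2 := by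
        refine add_le_add (le_trans ?_ hk) (le_trans (le_of_eq ?_) hn)
        · rw [hκ]
          dsimp only
          gcongr
          exact (gagliardo_le_HsNorm s _).trans (ENNReal.rpow_le_rpow (hmemsub _ _) zero_le_two)
        · congr 1
          refine Finset.sum_congr rfl fun z _ => ?_
          rw [← hsub _ _ ⟨k, z⟩]
      _ = ε := ENNReal.add_halves ε
  have hroot := ((ENNReal.continuous_rpow_const (y := (1 / 2 : ℝ))).tendsto 0).comp hsq
  rw [ENNReal.zero_rpow_of_pos (by norm_num)] at hroot
  refine hroot.congr fun k => ?_
  simp only [Function.comp_apply]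
  rw [← ENNReal.rpow_natCast, ← ENNReal.rpow_mul]
  norm_num

/-! ### Subcritical exponents and the compact embedding -/

/-- Interpolation between `L²` and `L^p`: large values are absorbed by the `L^p` norm, small ones by
the `L²` norm. -/
lemma eLpNorm_rpow_le_add {α : Type*} [MeasurableSpace α] {ν : Measure α} {p q K : ℝ}
    (hq : 2 ≤ q) (hqp : q ≤ p) (hK : 0 < K) {f : α → ℝ} (hf : AEMeasurable f ν) :
    eLpNorm f (ENNReal.ofReal q) ν ^ q ≤ ENNReal.ofReal (K ^ (q - 2)) * eLpNorm f 2 ν ^ 2 +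
      ENNReal.ofReal (K ^ (q - p)) * eLpNorm f (ENNReal.ofReal p) ν ^ p := by
  have hq0 : 0 < q := by linarith
  have hp0 : 0 < p := by linarith
  rw [eLpNorm_ofReal_rpow_eq_lintegral hq0, eLpNorm_ofReal_rpow_eq_lintegral hp0,
    eLpNorm_two_sq_eq_lintegral, ← lintegral_const_mul' _ _ ENNReal.ofReal_ne_top,
    ← lintegral_const_mul' _ _ ENNReal.ofReal_ne_top,
    ← lintegral_add_left' ((hf.enorm.pow_const 2).const_mul _)]
  refine lintegral_mono fun x => ?_
  have h0 := abs_nonneg (f x)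
  rw [Real.enorm_eq_ofReal_abs, ENNReal.ofReal_rpow_of_nonneg h0 hq0.le,
    ENNReal.ofReal_rpow_of_nonneg h0 hp0.le, ← ENNReal.ofReal_pow h0,
    ← ENNReal.ofReal_mul (by positivity), ← ENNReal.ofReal_mul (by positivity),
    ← ENNReal.ofReal_add (by positivity) (by positivity)]
  refine ENNReal.ofReal_le_ofReal ?_
  generalize |f x| = a at h0
  rcases eq_or_lt_of_le h0 with rfl | ha
  · rw [Real.zero_rpow hq0.ne', Real.zero_rpow hp0.ne']
    simp
  rcases le_total a K with hle | hle
  · calc a ^ q = a ^ (q - 2) * a ^ 2 := by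
          rw [← Real.rpow_natCast a 2, ← Real.rpow_add ha]; norm_num
      _ ≤ K ^ (q - 2) * a ^ 2 := by gcongr
      _ ≤ _ := le_add_of_nonneg_right (by positivity)
  · calc a ^ q = a ^ (q - p) * a ^ p := by rw [← Real.rpow_add ha]; norm_num
      _ ≤ K ^ (q - p) * a ^ p := mul_le_mul_of_nonneg_right
          (Real.rpow_le_rpow_of_nonpos hK hle (by linarith)) (by positivity)
      _ ≤ _ := le_add_of_nonneg_left (by positivity)

lemma tendsto_eLpNorm_of_tendsto_two {α ι : Type*} [MeasurableSpace α] {ν : Measure α}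
    {l : Filter ι} {p q : ℝ} (hq : 2 ≤ q) (hqp : q < p) {f : ι → α → ℝ}
    (hf : ∀ i, AEMeasurable (f i) ν) {B : ℝ≥0∞} (hB : B ≠ ∞)
    (hfB : ∀ i, eLpNorm (f i) (ENNReal.ofReal p) ν ≤ B)
    (hlim : Tendsto (fun i => eLpNorm (f i) 2 ν) l (𝓝 0)) :
    Tendsto (fun i => eLpNorm (f i) (ENNReal.ofReal q) ν) l (𝓝 0) := by
  have hq0 : 0 < q := by linarith
  have hp0 : 0 < p := by linarith
  have hBp : B ^ p ≠ ∞ := ENNReal.rpow_ne_top_of_nonneg hp0.le hB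
  have hpow : Tendsto (fun i => eLpNorm (f i) (ENNReal.ofReal q) ν ^ q) l (𝓝 0) := by
    rw [ENNReal.tendsto_nhds_zero]
    intro ε hε
    have hε2 : 0 < ε / 2 := ENNReal.half_pos hε.ne'
    have hKlim : Tendsto (fun K : ℝ => ENNReal.ofReal (K ^ (q - p)) * B ^ p) atTop (𝓝 0) := by
      have h1 : Tendsto (fun K : ℝ => K ^ (q - p)) atTop (𝓝 0) := by
        have := tendsto_rpow_neg_atTop (sub_pos.2 hqp)
        simpa using this
      have h2 := ENNReal.Tendsto.mul_const (ENNReal.tendsto_ofReal h1) (Or.inr hBp)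
      rwa [ENNReal.ofReal_zero, zero_mul] at h2
    obtain ⟨K, hK, hK0⟩ :=
      (((ENNReal.tendsto_nhds_zero.1 hKlim) _ hε2).and (eventually_gt_atTop 0)).exists
    have h1 : Tendsto (fun i => ENNReal.ofReal (K ^ (q - 2)) * eLpNorm (f i) 2 ν ^ 2) l (𝓝 0) := by
      have := ENNReal.Tendsto.const_mul (a := ENNReal.ofReal (K ^ (q - 2)))
        (ENNReal.Tendsto.pow (n := 2) hlim) (Or.inr ENNReal.ofReal_ne_top)
      simpa using this
    filter_upwards [(ENNReal.tendsto_nhds_zero.1 h1) _ hε2] with i hi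
    refine (eLpNorm_rpow_le_add hq hqp.le hK0 (hf i)).trans ?_
    rw [← ENNReal.add_halves ε]
    refine add_le_add hi (le_trans ?_ hK)
    gcongr
    exact hfB i
  have hroot := ((ENNReal.continuous_rpow_const (y := 1 / q)).tendsto 0).comp hpow
  rw [ENNReal.zero_rpow_of_pos (by positivity)] at hroot
  refine hroot.congr fun k => ?_
  simp only [Function.comp_apply]
  rw [← ENNReal.rpow_mul, mul_one_div_cancel hq0.ne', ENNReal.rpow_one]

lemma exists_memLp_tendsto_of_cauchy {α : Type*} [MeasurableSpace α] {ν : Measure α} {q : ℝ≥0∞}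
    (hq : 1 ≤ q) {f : ℕ → α → ℝ} (hf : ∀ n, MemLp (f n) q ν)
    (hcau : Tendsto (fun k : ℕ × ℕ => eLpNorm (f k.1 - f k.2) q ν) atTop (𝓝 0)) :
    ∃ w, MemLp w q ν ∧ Tendsto (fun n => eLpNorm (f n - w) q ν) atTop (𝓝 0) := by
  have : Fact (1 ≤ q) := ⟨hq⟩
  have hC : CauchySeq fun n => (hf n).toLp (f n) := by
    rw [Lp.cauchySeq_Lp_iff_cauchySeq_eLpNorm]
    refine hcau.congr fun k => eLpNorm_congr_ae ?_
    exact ((hf k.1).coeFn_toLp.sub (hf k.2).coeFn_toLp).symm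
  obtain ⟨w, hw⟩ := cauchySeq_tendsto_of_complete hC
  refine ⟨w, Lp.memLp w, ?_⟩
  rw [Lp.tendsto_Lp_iff_tendsto_eLpNorm'] at hw
  refine hw.congr fun n => eLpNorm_congr_ae ?_
  exact (hf n).coeFn_toLp.sub (ae_eq_refl _)

lemma critExp_gt_two {s : ℝ} (hN : 1 ≤ N) (hs : 0 < s) : 2 < critExp N s := by
  have hN0 : (0 : ℝ) < N := by exact_mod_cast hN
  unfold critExp
  split_ifs with h
  · have h2 : (2 : ℝ≥0∞) = ENNReal.ofReal 2 := by simp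
    have hd : 0 < (N : ℝ) - 2 * s := by linarith
    rw [h2, ENNReal.ofReal_lt_ofReal_iff (by positivity), lt_div_iff₀ hd]
    linarith
  · exact ENNReal.ofNat_lt_top

/-- The Rellich–Kondrachov theorem for the fractional Sobolev space `H^s(Ω)`. -/
theorem isCompactlyEmbedded_HsSpace_LqSpace (hN : 1 ≤ N) (hΩo : IsOpen Ω)
    (hΩb : Bornology.IsBounded Ω) (hΩL : HasLipschitzBoundary Ω) {s : ℝ} (hs : 0 < s) {q : ℝ≥0∞}
    (hq1 : 1 ≤ q) (hq : q < critExp N s) :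
    IsCompactlyEmbedded (HsSpace Ω s) (HsNorm Ω s) (LqSpace Ω q) (LqNorm Ω q) := by
  obtain ⟨c, hc, r₀, hr₀, hd⟩ := exists_measureDensity hΩo hΩb hΩL
  have hfin : IsFiniteMeasure (volume.restrict Ω) :=
    ⟨by rw [Measure.restrict_apply_univ]; exact hΩb.measure_lt_top⟩
  -- compactness is proved for an exponent `q' ≥ 2`, since the interpolation starts from `L²`
  obtain ⟨q', hqq', hq'2, hq'⟩ : ∃ q' : ℝ, q ≤ ENNReal.ofReal q' ∧ 2 ≤ q' ∧
      ENNReal.ofReal q' < critExp N s := by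
    refine ⟨(max q 2).toReal, ?_, ?_, ?_⟩
    all_goals have hmax : max q 2 ≠ ∞ := (max_lt (hq.trans_le le_top) ENNReal.ofNat_lt_top).ne
    · rw [ENNReal.ofReal_toReal hmax]
      exact le_max_left _ _
    · have := ENNReal.toReal_mono hmax (le_max_right q 2)
      simpa using this
    · rw [ENNReal.ofReal_toReal hmax]
      exact max_lt hq (critExp_gt_two hN hs)
  obtain ⟨p, hqp, hp⟩ := exists_sobolevBound_gt hN hc hr₀ hs hΩo hΩb hd hq'2 hq'
  obtain ⟨C, hC⟩ := hp.exists_forall_le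
  have hq'p : ENNReal.ofReal q' ≤ ENNReal.ofReal p := ENNReal.ofReal_le_ofReal hqp.le
  have hmem : ∀ u ∈ HsSpace Ω s, MemLp u q (volume.restrict Ω) := fun u hu =>
    MemLp.mono_exponent ⟨hu.1.aestronglyMeasurable,
      (hC u hu).trans_lt (ENNReal.mul_lt_top ENNReal.coe_lt_top hu.2)⟩ (hqq'.trans hq'p)
  have hcomp : ∀ q₂ : ℝ≥0∞, q ≤ q₂ → ∃ D : ℝ≥0∞, D ≠ ∞ ∧ ∀ f : EuclideanSpace ℝ (Fin N) → ℝ,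
      AEMeasurable f (volume.restrict Ω) →
      eLpNorm f q (volume.restrict Ω) ≤ eLpNorm f q₂ (volume.restrict Ω) * D := by
    intro q₂ h
    refine ⟨(volume.restrict Ω) univ ^ (1 / q.toReal - 1 / q₂.toReal), ?_, fun f hf =>
      eLpNorm_le_eLpNorm_mul_rpow_measure_univ h hf.aestronglyMeasurable⟩
    refine ENNReal.rpow_ne_top_of_nonneg (sub_nonneg.2 ?_) (measure_ne_top _ _)
    rcases eq_or_ne q₂ ∞ with rfl | hq₂
    · simp
    · have hqt : q ≠ ∞ := (hq.trans_le le_top).ne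
      have h0 : 0 < q.toReal := ENNReal.toReal_pos (zero_lt_one.trans_le hq1).ne' hqt
      exact one_div_le_one_div_of_le h0 (ENNReal.toReal_mono hq₂ h)
  refine { subset := hmem, bound := ?_, exists_subseq := ?_ }
  · obtain ⟨D, hD, hDle⟩ := hcomp _ (hqq'.trans hq'p)
    refine ⟨C * D.toNNReal, fun u hu => (hDle u hu.1).trans ?_⟩
    rw [ENNReal.coe_mul, ENNReal.coe_toNNReal hD, mul_right_comm]
    gcongr
    exact hC u hu
  · rintro u hu ⟨M, hM⟩
    obtain ⟨φ, hφ, hcau⟩ := exists_subseq_cauchy_two hc hr₀ hs hΩo hΩb hd hu hM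
    have hsubM : ∀ n m, HsNorm Ω s (u n - u m) ≤ 2 * M :=
      fun n m => HsNorm_sub_le (hu n).1 (hM n) (hM m)
    have hMt : (2 * M : ℝ≥0∞) ≠ ∞ := ENNReal.mul_ne_top ENNReal.ofNat_ne_top ENNReal.coe_ne_top
    have hsubm : ∀ n m, AEMeasurable (u n - u m) (volume.restrict Ω) :=
      fun n m => (hu n).1.sub (hu m).1
    have hcau' : Tendsto (fun k : ℕ × ℕ =>
        eLpNorm (u (φ k.1) - u (φ k.2)) (ENNReal.ofReal q') (volume.restrict Ω)) atTop (𝓝 0) := by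
      refine tendsto_eLpNorm_of_tendsto_two hq'2 hqp (fun k => hsubm _ _)
        (B := C * (2 * M)) (ENNReal.mul_ne_top ENNReal.coe_ne_top hMt) (fun k => ?_) hcau
      refine (hC _ ⟨hsubm _ _, (hsubM _ _).trans_lt hMt.lt_top⟩).trans ?_
      gcongr
      exact hsubM _ _
    have hcauq : Tendsto (fun k : ℕ × ℕ =>
        eLpNorm (u (φ k.1) - u (φ k.2)) q (volume.restrict Ω)) atTop (𝓝 0) := by
      obtain ⟨D, hD, hDle⟩ := hcomp _ hqq'
      have h1 := ENNReal.Tendsto.mul_const hcau' (Or.inr hD)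
      rw [zero_mul] at h1
      exact tendsto_of_tendsto_of_tendsto_of_le_of_le tendsto_const_nhds h1 (fun _ => zero_le)
        fun k => hDle _ (hsubm _ _)
    obtain ⟨w, hw, hlim⟩ := exists_memLp_tendsto_of_cauchy hq1 (fun n => hmem _ (hu (φ n))) hcauq
    exact ⟨w, hw, φ, hφ, hlim⟩

lemma IsContinuouslyEmbedded.trans_isCompactlyEmbedded
    {U V W : Set (EuclideanSpace ℝ (Fin N) → ℝ)}
    {p₁ p₂ p₃ : (EuclideanSpace ℝ (Fin N) → ℝ) → ℝ≥0∞} (h₁ : IsContinuouslyEmbedded U p₁ V p₂)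
    (h₂ : IsCompactlyEmbedded V p₂ W p₃) : IsCompactlyEmbedded U p₁ W p₃ := by
  obtain ⟨C₁, hC₁⟩ := h₁.bound
  obtain ⟨C₂, hC₂⟩ := h₂.bound
  refine { subset := h₁.subset.trans h₂.subset, bound := ⟨C₂ * C₁, fun u hu => ?_⟩,
           exists_subseq := ?_ }
  · rw [ENNReal.coe_mul, mul_assoc]
    exact (hC₂ u (h₁.subset hu)).trans (mul_le_mul_right (hC₁ u hu) _)
  · rintro u hu ⟨M, hM⟩
    refine h₂.exists_subseq u (fun n => h₁.subset (hu n)) ⟨C₁ * M, fun n => ?_⟩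
    rw [ENNReal.coe_mul]
    exact (hC₁ _ (hu n)).trans (mul_le_mul_right (hM n) _)

end SuperposedFractional

theorem proposition2p3 (N : ℕ) (hN : 1 ≤ N)
    (Ω : Set (EuclideanSpace ℝ (Fin N))) (hΩo : IsOpen Ω) (hΩb : Bornology.IsBounded Ω)
    (hΩL : SuperposedFractional.HasLipschitzBoundary Ω)
    (g : EuclideanSpace ℝ (Fin N) → ℝ) (hg : IntegrableOn g Ωᶜ volume)
    (μ : Measure ℝ) [IsFiniteMeasure μ]
    (s : ℝ) (hs : s ∈ Ioo (0 : ℝ) 1) (hμs : 0 < μ (Ico s 1)) :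
    SuperposedFractional.IsContinuouslyEmbedded
        (SuperposedFractional.HmuSpace Ω g μ) (SuperposedFractional.muNorm Ω g μ)
        (SuperposedFractional.HsSpace Ω s) (SuperposedFractional.HsNorm Ω s) ∧
      ∀ q : ℝ≥0∞, 1 ≤ q → q < SuperposedFractional.critExp N s →
        SuperposedFractional.IsCompactlyEmbedded
          (SuperposedFractional.HmuSpace Ω g μ) (SuperposedFractional.muNorm Ω g μ)
          (SuperposedFractional.LqSpace Ω q) (SuperposedFractional.LqNorm Ω q) := by
  have hemb := SuperposedFractional.isContinuouslyEmbedded_HmuSpace_HsSpace hΩo hΩb g μ hs hμs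
  exact ⟨hemb, fun q hq1 hq => hemb.trans_isCompactlyEmbedded
    (SuperposedFractional.isCompactlyEmbedded_HsSpace_LqSpace hN hΩo hΩb hΩL hs.1 hq1 hq)⟩
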